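/- **Setting.** Let $A:\mathbb R^n\rightrightarrows\mathbb R^n$ and $B:\mathbb R^m\rightrightarrows\mathbb R^m$ be outer semicontinuous set-valued operators (i.e. with closed graphs), let $L\in\mathbb R^{m\times n}$ be nonzero with spectral norm $\|L\|$, and let $\|L\|=\sigma_1>\sigma_2>\dots>\sigma_d>0$ be its distinct strictly positive singular values. Let $$T_{\rm PD}(x,y)=(Ax+L^\top y)\times(B^{-1}y-Lx),\qquad \operatorname{zer}T_{\rm PD}=\{z\in\mathbb R^{n+m}: 0\in T_{\rm PD}z\}.$$ For $\gamma,\tau>0$ and $\lambda_k>0$, the Chambolle–Pock algorithm generates $z^k=(x^k,y^k)$ and $\bar z^k=(\bar x^k,\bar y^k)$ from an arbitrary $z^0$ by $$\bar x^k\in J_{\gamma A}(x^k-\gamma L^\top y^k),\quad \bar y^k\in J_{\tau B^{-1}}(y^k+\tau L(2\bar x^k-x^k)),\quad z^{k+1}=z^k+\lambda_k(\bar z^k-z^k),$$ where $J_C=(\mathrm{id}+C)^{-1}$. Put $P=\begin{bmatrix}\frac1\gamma I_n&-L^\top\\-L&\frac1\tau I_m\end{bmatrix}$ and let $\Pi$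 be the orthogonal projection onto the range of $P$. For symmetric $M,R$, an operator $C$ is $(M,R)$-semimonotone at $(\tilde x,\tilde y)\in\operatorname{gph}C$ if $\langle x-\tilde x,y-\tilde y\rangle\ge\langle x-\tilde x,M(x-\tilde x)\rangle+\langle y-\tilde y,R(y-\tilde y)\rangle$ for all $(x,y)\in\operatorname{gph}C$. Write $[t]_-=\min\{0,t\}$ and, for reals, $a\,\Box\,b=\frac{ab}{a+b}$ if $a+b\neq0$ and $0\,\Box\,0=0$. **Assumptions.** $J_{\gamma A}$ and $J_{\tau B^{-1}}$ have full domain. There is a nonempty set $\mathcal S^\star\subseteq\operatorname{zer}T_{\rm PD}$ such that for every $(x^\star,y^\star)\in\mathcal S^\star$, $A$ is $(\mu_AL^\top L,\rho_AI_n)$-semimonotone at $(x^\star,-L^\top y^\star)$ and $B$ is $(\mu_BI_m,\rho_BLL^\top)$-semimonotone at $(Lx^\star,y^\star)$, where $(\mu_A,\mu_B,\rho_A,\rho_B)\in\mathbb R^4$ satisfies one of: 1. $\mu_A=\mu_B=0$ and $\rho_A=\rho_B=0$; 2. $\mu_A+\mu_B>0$ and $\rho_A=\rho_B=0$; 3.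 $\rho_A+\rho_B>0$ and $\mu_A=\mu_B=0$; 4. $\mu_A+\mu_B>0$, $\rho_A+\rho_B>0$ and $[\mu_A\Box\mu_B]_-[\rho_A\Box\rho_B]_-<\frac1{4\|L\|^2}$. **Stepsize rule.** Put $\beta_P=\rho_A\Box\rho_B$, $\beta_D=\mu_A\Box\mu_B$, $\delta=1+[\beta_P\beta_D]_-(\|L\|^2-\sigma_d^2)$ and $$\gamma_{\min}=-\frac{2\beta_P}{\delta+\sqrt{\delta^2-4\beta_P\beta_D\|L\|^2}},\quad \gamma_{\max}=-\frac{\delta+\sqrt{\delta^2-4\beta_P\beta_D\|L\|^2}}{2\beta_D\|L\|^2},\quad \tau_{\min}(\gamma)=-\frac{\beta_D(\gamma+\beta_P)}{\gamma(\delta-\beta_P\beta_D\|L\|^2)+\beta_P}.$$ The stepsizes satisfy the following. * If ($\mu_A=\mu_B=0$, or $\mu_A+\mu_B>0$ and $\mu_A\mu_B\ge0$) and ($\rho_A=\rho_B=0$, or $\rho_A+\rho_B>0$ and $\rho_A\rho_B\ge0$): $\gamma\in(0,\infty)$, $\tau\in(0,\frac1{\gamma\|L\|^2}]$. * If $\mu_A+\mu_B>0$,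 $\mu_A\mu_B<0$, $\rho_A=\rho_B=0$: $\gamma\in(0,-\frac1{\beta_D\|L\|^2})$, $\tau\in(-\beta_D,\frac1{\gamma\|L\|^2}]$. * If $\mu_A+\mu_B>0$, $\mu_A\mu_B<0$, $\rho_A+\rho_B>0$, $\rho_A\rho_B\ge0$: $\gamma\in(0,\gamma_{\max})$, $\tau\in(\tau_{\min}(\gamma),\frac1{\gamma\|L\|^2}]$. * If $\mu_A=\mu_B=0$, $\rho_A+\rho_B>0$, $\rho_A\rho_B<0$: $\gamma\in(-\beta_P,\infty)$, $\tau\in(0,\frac1{\gamma\|L\|^2}]$. * If $\mu_A+\mu_B>0$, $\mu_A\mu_B\ge0$, $\rho_A+\rho_B>0$, $\rho_A\rho_B<0$: $\gamma\in(\gamma_{\min},\infty)$, $\tau\in(0,\frac1{\gamma\|L\|^2}]$. * If $\mu_A+\mu_B>0$, $\mu_A\mu_B<0$, $\rho_A+\rho_B>0$, $\rho_A\rho_B<0$: $\gamma\in(\gamma_{\min},\gamma_{\max})$, $\tau\in(\tau_{\min}(\gamma),\frac1{\gamma\|L\|^2}]$. **Relaxation rule.** Let $\Delta=\frac{\beta_P}{2\gamma}+\frac{\beta_D}{2\tau}$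 and $\theta(\sigma)=\sqrt{\big(\frac{\beta_P}{2\gamma}-\frac{\beta_D}{2\tau}\big)^2+\beta_P\beta_D\sigma^2}$. Let $\eta'$ be the minimum of $1+\frac{\rho_A}\gamma$ (included only if $\operatorname{rank}L<n$) and $1+\frac{\mu_B}\tau$ (included only if $\operatorname{rank}L<m$), with $\eta'=+\infty$ if $\operatorname{rank}L=n=m$. Define $\bar\eta$ as follows. * If $\gamma\tau<\frac1{\|L\|^2}$: $\bar\eta=1+\Delta-\theta(\|L\|)$ if $\mu_A\mu_B\rho_A\rho_B\ge0$, and $\bar\eta=\min\{1+\Delta-\theta(\sigma_d),\eta'\}$ otherwise. * If $\gamma\tau=\frac1{\|L\|^2}$ and $d=1$: $\bar\eta=1+2\Delta$ if $\max\{\mu_A\mu_B,\rho_A\rho_B\}\le0$, and $\bar\eta=\min\{1+2\Delta,\eta'\}$ otherwise. * If $\gamma\tau=\frac1{\|L\|^2}$ and $d>1$: $\bar\eta=1+2\Delta$ if $\max\{\mu_A\mu_B,\rho_A\rho_B\}\le0$; $\bar\eta=1+\Delta-\theta(\sigma_2)$ if $\min\{\mu_A\mu_B,\rho_A\rho_B\}>0$;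 and $\bar\eta=\min\{1+\Delta-\theta(\sigma_d),\eta'\}$ otherwise. The relaxation parameters satisfy $\lambda_k\in(0,2\bar\eta)$ for all $k$ and $\liminf_{k\to\infty}\lambda_k(2\bar\eta-\lambda_k)>0$. **Conclusion.** Either $\bar z^k\in\operatorname{zer}T_{\rm PD}$ for some $k$, or the following hold: 1. $\bar v^k:=P(z^k-\bar z^k)\in T_{\rm PD}\bar z^k$ for all $k$, and $\bar v^k\to0$; 2. every limit point of $(\bar z^k)$ belongs to $\operatorname{zer}T_{\rm PD}$; 3. the sequences $(\Pi z^k)$ and $(\Pi\bar z^k)$ are bounded. Moreover, if $J_{\gamma A}$ and $J_{\tau B^{-1}}$ are (single-valued and) continuous, then 4. the limit points of $(\Pi z^k)$ belong to $\Pi\operatorname{zer}T_{\rm PD}$; 5. if $\mathcal S^\star=\operatorname{zer}T_{\rm PD}$, then $(\Pi z^k)$ converges to an element of $\Pi\operatorname{zer}T_{\rm PD}$ and $(\bar z^k)$ converges to an element of $\operatorname{zer}T_{\rm PD}$; if in addition $\lambda_k\in[\varepsilon,2-\varepsilon]$ for all $k$ and some $\varepsilon>0$, then $(z^k)$ converges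 to an element of $\operatorname{zer}T_{\rm PD}$. -/

import Mathlib

noncomputable section

namespace ChambollePock

open Filter Topology
open scoped Matrix Matrix.Norms.L2Operator

/-- The Euclidean space with coordinates indexed by `ι`; `Vec (Fin n)` is `ℝⁿ`. -/
abbrev Vec (ι : Type) := EuclideanSpace ℝ ι

/-- Set-valued operators on a Euclidean space. -/
abbrev SetOp (ι : Type) := Vec ι → Set (Vec ι)

/-- The action of a matrix on a Euclidean vector. -/
abbrev act {ι κ : Type} [Fintype ι] [DecidableEq ι] (M : Matrix κ ι ℝ) (v : Vec ι) : Vec κ :=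
  Matrix.toEuclideanLin M v

/-- The vector `(x, y)` of `ℝⁿ⁺ᵐ`. -/
def pair {n m : ℕ} (x : Vec (Fin n)) (y : Vec (Fin m)) : Vec (Fin n ⊕ Fin m) :=
  WithLp.toLp 2 (Sum.elim x y)

/-! ### Set-valued operators -/

section Operators

variable {ι : Type}

/-- The zeros of an operator. -/
def zer (A : SetOp ι) : Set (Vec ι) := {x | 0 ∈ A x}

/-- The inverse operator. -/
def invOp (A : SetOp ι) : SetOp ι := fun y => {x | y ∈ A x}

/-- The operator `c A`. -/
def scale (c : ℝ) (A : SetOp ι) : SetOp ι := fun x => {v | ∃ a ∈ A x, v = c • a}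

/-- The resolvent `J_A = (id + A)⁻¹`. -/
def resolventOp (A : SetOp ι) : SetOp ι := invOp fun x => {v | ∃ a ∈ A x, v = x + a}

/-- The domain of the operator is the whole space. -/
def FullDomain (A : SetOp ι) : Prop := ∀ x, (A x).Nonempty

/-- The operator is single-valued and continuous. -/
def SingleValuedContinuous (A : SetOp ι) : Prop :=
  ∃ f : Vec ι → Vec ι, Continuous f ∧ ∀ x, A x = {f x}

/-- Outer semicontinuity at `x₀`: the outer limit of `A x` as `x → x₀` is contained in `A x₀`. -/
def OuterSemicontinuousAt (A : SetOp ι) (x₀ : Vec ι) : Prop :=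
  ∀ (u v : ℕ → Vec ι) (w : Vec ι), Tendsto u atTop (𝓝 x₀) → Tendsto v atTop (𝓝 w) →
    (∀ k, v k ∈ A (u k)) → w ∈ A x₀

/-- Outer semicontinuity everywhere. -/
def OuterSemicontinuous (A : SetOp ι) : Prop := ∀ x₀, OuterSemicontinuousAt A x₀

variable [Fintype ι] [DecidableEq ι]

/-- The quadratic form `⟨v, M v⟩`. -/
def qform (M : Matrix ι ι ℝ) (v : Vec ι) : ℝ := inner ℝ v (act M v)

/-- `(M, R)`-semimonotonicity of `A` at `(x₀, y₀) ∈ graph A`, for symmetric matrices `M`, `R`. -/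
def SemimonotoneAt (A : SetOp ι) (M R : Matrix ι ι ℝ) (x₀ y₀ : Vec ι) : Prop :=
  y₀ ∈ A x₀ ∧
    ∀ x, ∀ y ∈ A x, qform M (x - x₀) + qform R (y - y₀) ≤ inner ℝ (x - x₀) (y - y₀)

end Operators

/-! ### The primal-dual operator, the preconditioner and the algorithm -/

section Algorithm

variable {n m : ℕ}

/-- The primal-dual operator `(x, y) ↦ (A x + Lᵀ y) × (B⁻¹ y - L x)`. -/
def primalDual (A : SetOp (Fin n)) (B : SetOp (Fin m)) (L : Matrix (Fin m) (Fin n) ℝ) :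
    SetOp (Fin n ⊕ Fin m) :=
  fun z => {w | ∃ x y, z = pair x y ∧ ∃ a ∈ A x, ∃ b ∈ invOp B y,
    w = pair (a + act Lᵀ y) (b - act L x)}

/-- The preconditioner with blocks `I / γ`, `-Lᵀ`, `-L`, `I / τ`. -/
def precond (L : Matrix (Fin m) (Fin n) ℝ) (γ τ : ℝ) :
    Matrix (Fin n ⊕ Fin m) (Fin n ⊕ Fin m) ℝ :=
  Matrix.fromBlocks ((1 / γ) • 1) (-Lᵀ) (-L) ((1 / τ) • 1)

/-- The orthogonal projection onto the range of the preconditioner. -/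
def projRange (L : Matrix (Fin m) (Fin n) ℝ) (γ τ : ℝ) (z : Vec (Fin n ⊕ Fin m)) :
    Vec (Fin n ⊕ Fin m) :=
  (LinearMap.range (Matrix.toEuclideanLin (precond L γ τ))).starProjection z

/-- `(x, y, xb, yb)` is generated by the relaxed Chambolle–Pock algorithm with stepsizes `γ`, `τ`
and relaxation parameters `lam k`. -/
def IsGenerated (A : SetOp (Fin n)) (B : SetOp (Fin m)) (L : Matrix (Fin m) (Fin n) ℝ)
    (γ τ : ℝ) (lam : ℕ → ℝ) (x : ℕ → Vec (Fin n)) (y : ℕ → Vec (Fin m))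
    (xb : ℕ → Vec (Fin n)) (yb : ℕ → Vec (Fin m)) : Prop :=
  ∀ k, xb k ∈ resolventOp (scale γ A) (x k - γ • act Lᵀ (y k)) ∧
    yb k ∈ resolventOp (scale τ (invOp B)) (y k + τ • act L ((2 : ℝ) • xb k - x k)) ∧
    x (k + 1) = x k + lam k • (xb k - x k) ∧
    y (k + 1) = y k + lam k • (yb k - y k)

end Algorithm

/-! ### Moduli, stepsizes and relaxation parameters -/

section Rules

/-- The parallel sum `a □ b`, used when `a + b ≠ 0` or `a = b = 0` (where `0 / 0 = 0` is the
convention). -/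
def parSum (a b : ℝ) : ℝ := a * b / (a + b)

/-- The negative part `[t]₋ = min {0, t}`. -/
def negPart (t : ℝ) : ℝ := min 0 t

variable {n m : ℕ} (L : Matrix (Fin m) (Fin n) ℝ)

/-- The set of strictly positive singular values of `L`. -/
def posSingularValues : Set ℝ :=
  {s | 0 < s ∧ ∃ i, (Matrix.toEuclideanLin L).singularValues i = s}

/-- The number `d` of distinct strictly positive singular values. -/
def numSingularValues : ℕ := (posSingularValues L).ncard

/-- The smallest strictly positive singular value `σ_d`. -/
def sigmaMin : ℝ := sInf (posSingularValues L)

/-- The second largest distinct strictly positive singular value `σ₂` (used when `d > 1`); the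
largest one is the spectral norm `‖L‖`. -/
def sigmaTwo : ℝ := sSup {s ∈ posSingularValues L | s < ‖L‖}

variable (μA μB ρA ρB : ℝ)

/-- The four admissible cases for the semimonotonicity moduli. -/
def ModuliCondition : Prop :=
  (μA = 0 ∧ μB = 0 ∧ ρA = 0 ∧ ρB = 0) ∨
  (0 < μA + μB ∧ ρA = 0 ∧ ρB = 0) ∨
  (0 < ρA + ρB ∧ μA = 0 ∧ μB = 0) ∨
  (0 < μA + μB ∧ 0 < ρA + ρB ∧
    negPart (parSum μA μB) * negPart (parSum ρA ρB) < 1 / (4 * ‖L‖ ^ 2))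

/-- `δ = 1 + [(μA □ μB)(ρA □ ρB)]₋ (‖L‖² - σ_d²)`. -/
def delta : ℝ := 1 + negPart (parSum μA μB * parSum ρA ρB) * (‖L‖ ^ 2 - sigmaMin L ^ 2)

/-- `√(δ² - 4 (μA □ μB)(ρA □ ρB) ‖L‖²)`. -/
def sqrtDisc : ℝ :=
  √(delta L μA μB ρA ρB ^ 2 - 4 * (parSum μA μB * parSum ρA ρB) * ‖L‖ ^ 2)

def gammaMin : ℝ :=
  -(2 * parSum ρA ρB / (delta L μA μB ρA ρB + sqrtDisc L μA μB ρA ρB))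

def gammaMax : ℝ :=
  -((delta L μA μB ρA ρB + sqrtDisc L μA μB ρA ρB) / (2 * parSum μA μB * ‖L‖ ^ 2))

def tauMin (γ : ℝ) : ℝ :=
  -(parSum μA μB * (γ + parSum ρA ρB) /
    (γ * (delta L μA μB ρA ρB - parSum μA μB * parSum ρA ρB * ‖L‖ ^ 2) + parSum ρA ρB))

variable (γ τ : ℝ)

/-- The look-up table for the stepsizes, cell by cell. -/
def StepsizeRule : Prop :=
  ((μA = 0 ∧ μB = 0 ∨ 0 < μA + μB ∧ 0 ≤ μA * μB) ∧
    (ρA = 0 ∧ ρB = 0 ∨ 0 < ρA + ρB ∧ 0 ≤ ρA * ρB) ∧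
    0 < γ ∧ τ ∈ Set.Ioc 0 (1 / (γ * ‖L‖ ^ 2))) ∨
  ((0 < μA + μB ∧ μA * μB < 0) ∧
    (ρA = 0 ∧ ρB = 0) ∧
    γ ∈ Set.Ioo 0 (-(1 / (parSum μA μB * ‖L‖ ^ 2))) ∧
    τ ∈ Set.Ioc (-parSum μA μB) (1 / (γ * ‖L‖ ^ 2))) ∨
  ((0 < μA + μB ∧ μA * μB < 0) ∧
    (0 < ρA + ρB ∧ 0 ≤ ρA * ρB) ∧
    γ ∈ Set.Ioo 0 (gammaMax L μA μB ρA ρB) ∧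
    τ ∈ Set.Ioc (tauMin L μA μB ρA ρB γ) (1 / (γ * ‖L‖ ^ 2))) ∨
  ((μA = 0 ∧ μB = 0) ∧
    (0 < ρA + ρB ∧ ρA * ρB < 0) ∧
    -parSum ρA ρB < γ ∧ τ ∈ Set.Ioc 0 (1 / (γ * ‖L‖ ^ 2))) ∨
  ((0 < μA + μB ∧ 0 ≤ μA * μB) ∧
    (0 < ρA + ρB ∧ ρA * ρB < 0) ∧
    gammaMin L μA μB ρA ρB < γ ∧ τ ∈ Set.Ioc 0 (1 / (γ * ‖L‖ ^ 2))) ∨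
  ((0 < μA + μB ∧ μA * μB < 0) ∧
    (0 < ρA + ρB ∧ ρA * ρB < 0) ∧
    γ ∈ Set.Ioo (gammaMin L μA μB ρA ρB) (gammaMax L μA μB ρA ρB) ∧
    τ ∈ Set.Ioc (tauMin L μA μB ρA ρB γ) (1 / (γ * ‖L‖ ^ 2)))

/-- `Δ = (ρA □ ρB) / (2γ) + (μA □ μB) / (2τ)`. -/
def bigDelta : ℝ := parSum ρA ρB / (2 * γ) + parSum μA μB / (2 * τ)

/-- `θ(σ) = √(((ρA □ ρB) / (2γ) - (μA □ μB) / (2τ))² + (μA □ μB)(ρA □ ρB) σ²)`. -/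
def theta (σ : ℝ) : ℝ :=
  √((parSum ρA ρB / (2 * γ) - parSum μA μB / (2 * τ)) ^ 2
    + parSum μA μB * parSum ρA ρB * σ ^ 2)

/-- The extended real number `η'`, according to the rank of `L`. -/
def etaPrime : EReal :=
  if L.rank = m then
    if L.rank = n then ⊤ else ((1 + ρA / γ : ℝ) : EReal)
  else
    if L.rank = n then ((1 + μB / τ : ℝ) : EReal)
    else ((min (1 + ρA / γ) (1 + μB / τ) : ℝ) : EReal)

/-- The real number `min {t, η'}`. -/
def minEtaPrime (t : ℝ) : ℝ := (min (t : EReal) (etaPrime L μB ρA γ τ)).toReal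

/-- The number `η̄`, for stepsizes with `γ τ ≤ 1 / ‖L‖²`. -/
def etaBar : ℝ :=
  if γ * τ < 1 / ‖L‖ ^ 2 then
    if 0 ≤ μA * μB * ρA * ρB then
      1 + bigDelta μA μB ρA ρB γ τ - theta μA μB ρA ρB γ τ ‖L‖
    else
      minEtaPrime L μB ρA γ τ
        (1 + bigDelta μA μB ρA ρB γ τ - theta μA μB ρA ρB γ τ (sigmaMin L))
  else if numSingularValues L = 1 then
    if max (μA * μB) (ρA * ρB) ≤ 0 then
      1 + 2 * bigDelta μA μB ρA ρB γ τ
    else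
      minEtaPrime L μB ρA γ τ (1 + 2 * bigDelta μA μB ρA ρB γ τ)
  else
    if max (μA * μB) (ρA * ρB) ≤ 0 then
      1 + 2 * bigDelta μA μB ρA ρB γ τ
    else if 0 < min (μA * μB) (ρA * ρB) then
      1 + bigDelta μA μB ρA ρB γ τ - theta μA μB ρA ρB γ τ (sigmaTwo L)
    else
      minEtaPrime L μB ρA γ τ
        (1 + bigDelta μA μB ρA ρB γ τ - theta μA μB ρA ρB γ τ (sigmaMin L))

/-- The condition on the relaxation parameters. -/
def RelaxationRule (lam : ℕ → ℝ) : Prop :=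
  (∀ k, lam k ∈ Set.Ioo 0 (2 * etaBar L μA μB ρA ρB γ τ)) ∧
  0 < liminf (fun k => lam k * (2 * etaBar L μA μB ρA ρB γ τ - lam k)) atTop

end Rules

end ChambollePock

end

open ChambollePock Filter Topology
open scoped Matrix

/-! The iteration is a relaxed, preconditioned proximal point method: with P = `precond L γ τ`, the
vector P(zᵏ - z̄ᵏ) lies in T_PD z̄ᵏ (`precond_residual_mem`). The bound γτ‖L‖² ≤ 1 makes P positive
semidefinite, possibly singular; write ‖u‖_P² = ⟨u, Pu⟩.

Everything rests on a weak Minty inequality (`weak_minty`): ⟨z̄ - w, P(z - z̄)⟩ ≥ (η̄ - 1)‖z -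
z̄‖_P² for w in S⋆. Adding the semimonotonicity inequalities of A and B cancels the coupling through
L and leaves four quadratic terms. These split along the right singular vectors of L
(`spectral_bound`). Minimizing over the components not determined by P(z - z̄) replaces each pair of
moduli by its parallel sum, so every positive singular value leaves one binary quadratic form
(`scalar_bound`, `block_nonneg`); the kernels of L and Lᵀ give the two terms of η'. The table for η̄
stays below all these bounds (`etaBar_bounds`).

Each step then lowers ‖z - w‖_P² by at least λ(2η̄ - λ)‖z - z̄‖_P² (`seminorm_step`), so the
residual vanishes, and closedness of the graphs makes limit points of z̄ᵏ zeros. Only P zᵏ is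
controlled, but with continuous resolvents z̄ᵏ is a continuous function of P zᵏ
(`exists_continuous_step`), which transfers convergence to z̄ᵏ; the relaxed averaging then transfers
it to zᵏ. -/

noncomputable section

namespace ChambollePock

open Filter Topology
open scoped Matrix Matrix.Norms.L2Operator

/-! ### Scalar inequalities -/

/-- A binary quadratic form with nonnegative diagonal and nonnegative determinant is
nonnegative. -/
lemma quadForm_nonneg {p q r : ℝ} (hp : 0 ≤ p) (hr : 0 ≤ r) (h : q ^ 2 ≤ p * r) (x y : ℝ) :
    0 ≤ p * x ^ 2 + 2 * q * x * y + r * y ^ 2 := by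
  rcases hp.eq_or_lt with rfl | hp
  · have : q = 0 := by nlinarith [sq_nonneg q]
    subst this
    nlinarith [mul_nonneg hr (sq_nonneg y)]
  · have h1 : 0 ≤ p * (p * x ^ 2 + 2 * q * x * y + r * y ^ 2) := by
      nlinarith [sq_nonneg (p * x + q * y), mul_nonneg (sub_nonneg.2 h) (sq_nonneg y)]
    exact nonneg_of_mul_nonneg_right h1 hp

/-- Nonnegativity of a `2 × 2` block, in normalized variables. -/
lemma block_nonneg {a d κ c : ℝ} (hκ0 : 0 ≤ κ) (hκ1 : κ ≤ 1)
    (hc : κ = 1 ∧ c ≤ a + d ∨ c ≤ (a + d) / 2 - √(((a - d) / 2) ^ 2 + a * d * κ)) (x w : ℝ) :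
    0 ≤ a * (x - κ * w) ^ 2 + d * κ * (w - x) ^ 2 - c * (x ^ 2 - 2 * κ * x * w + κ * w ^ 2) := by
  set R := ((a - d) / 2) ^ 2 + a * d * κ with hR
  -- R = ((a + d) / 2)² - ad(1 - κ), so this is ad ≤ ((a + d) / 2)² in disguise. It makes R
  -- nonnegative and later controls the trace.
  have hRle : ((a + d) / 2 * κ) ^ 2 ≤ R := by
    have : 0 ≤ (1 - κ) * (((a + d) / 2) ^ 2 * (1 + κ) - a * d) := by
      apply mul_nonneg (by linarith)
      nlinarith [sq_nonneg (a - d), mul_nonneg hκ0 (sq_nonneg ((a + d) / 2))]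
    nlinarith
  have hR0 : 0 ≤ R := (sq_nonneg _).trans hRle
  have hθ : (a + d) / 2 * κ ≤ √R := Real.le_sqrt_of_sq_le hRle
  have hsq := Real.sq_sqrt hR0
  have hθ0 := Real.sqrt_nonneg R
  rcases hκ1.eq_or_lt with rfl | hκ
  · have hc' : c ≤ a + d := by
      rcases hc with h | h
      · exact h.2
      · have : -((a + d) / 2) ≤ √R := Real.le_sqrt_of_sq_le (by linarith [hRle])
        linarith
    nlinarith [mul_nonneg (sub_nonneg.2 hc') (sq_nonneg (x - w))]
  · have hc' : c ≤ (a + d) / 2 - √R := by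
      rcases hc with h | h
      · exact absurd h.1 hκ.ne
      · exact h
    -- c lies below the smaller root of the determinant, regarded as a quadratic in c.
    have hdet : 0 ≤ (c - (a + d) / 2) ^ 2 - R := by
      nlinarith [mul_nonneg hθ0 (show 0 ≤ (a + d) / 2 - √R - c by linarith)]
    have hprod : κ * c ^ 2 ≤ (a * (1 - κ) - c) * (d * (1 - κ) - c) := by
      nlinarith [mul_nonneg (sub_nonneg.2 hκ.le) hdet]
    have hsum : 0 ≤ (a * (1 - κ) - c) + (d * (1 - κ) - c) := by linarith
    have hprod0 : 0 ≤ (a * (1 - κ) - c) * (d * (1 - κ) - c) :=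
      (mul_nonneg hκ0 (sq_nonneg c)).trans hprod
    have hboth : 0 ≤ a * (1 - κ) - c ∧ 0 ≤ d * (1 - κ) - c := by
      rcases mul_nonneg_iff.1 hprod0 with h | h
      · exact h
      · constructor <;> linarith [h.1, h.2]
    -- With X = x - κw and Y = w - x, (1 - κ)(x² - 2κxw + κw²) = X² + 2κXY + κY²; hence the target
    -- times 1 - κ is this form in X and Y.
    have hq := quadForm_nonneg (p := a * (1 - κ) - c) (q := -(c * κ))
      (r := κ * (d * (1 - κ) - c)) hboth.1 (mul_nonneg hκ0 hboth.2)
      (by nlinarith [mul_le_mul_of_nonneg_left hprod hκ0]) (x - κ * w) (w - x)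
    refine nonneg_of_mul_nonneg_right (a := 1 - κ) ?_ (by linarith)
    exact hq.trans_eq (by ring)

/-! ### Parallel sums of the moduli. -/

/-- The part of the look-up tables used for the moduli: either both vanish or their sum is
positive. -/
def ModuliPair (a b : ℝ) : Prop := a = 0 ∧ b = 0 ∨ 0 < a + b

lemma ModuliPair.symm {a b : ℝ} (h : ModuliPair a b) : ModuliPair b a := by
  rcases h with h | h
  · exact Or.inl h.symm
  · exact Or.inr (by linarith)

lemma parSum_comm (a b : ℝ) : parSum a b = parSum b a := by
  simp only [parSum, mul_comm, add_comm]

lemma parSum_le_left {a b : ℝ} (h : ModuliPair a b) : parSum a b ≤ a := by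
  rcases h with ⟨rfl, rfl⟩ | h
  · simp [parSum]
  · rw [parSum, div_le_iff₀ h]
    nlinarith [sq_nonneg a]

lemma parSum_le_right {a b : ℝ} (h : ModuliPair a b) : parSum a b ≤ b :=
  parSum_comm a b ▸ parSum_le_left h.symm

/-- Variational meaning of the parallel sum: for a + b > 0 it is the minimum of ap² + bq² over q - p
= 1, even when one modulus is negative. The defect is (ap + bq)² / (a + b). -/
lemma parSum_mul_sq_le {a b : ℝ} (h : ModuliPair a b) (p q : ℝ) :
    parSum a b * (q - p) ^ 2 ≤ a * p ^ 2 + b * q ^ 2 := by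
  rcases h with ⟨rfl, rfl⟩ | h
  · simp [parSum]
  · rw [parSum, div_mul_eq_mul_div, div_le_iff₀ h]
    nlinarith [sq_nonneg (a * p + b * q)]

lemma parSum_nonneg {a b : ℝ} (h : ModuliPair a b) (hab : 0 ≤ a * b) : 0 ≤ parSum a b := by
  rcases h with ⟨rfl, rfl⟩ | h
  · simp [parSum]
  · exact div_nonneg hab h.le

lemma parSum_nonpos {a b : ℝ} (h : ModuliPair a b) (hab : a * b ≤ 0) : parSum a b ≤ 0 := by
  rcases h with ⟨rfl, rfl⟩ | h
  · simp [parSum]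
  · exact div_nonpos_of_nonpos_of_nonneg hab h.le

lemma parSum_mul_parSum_nonneg {a b c d : ℝ} (h : ModuliPair a b) (h' : ModuliPair c d)
    (habcd : 0 ≤ a * b * c * d) : 0 ≤ parSum a b * parSum c d := by
  rcases h with ⟨rfl, rfl⟩ | h
  · simp [parSum]
  rcases h' with ⟨rfl, rfl⟩ | h'
  · simp [parSum]
  rw [parSum, parSum, div_mul_div_comm]
  exact div_nonneg (by linarith) (mul_pos h h').le

lemma parSum_mul_parSum_nonpos {a b c d : ℝ} (h : ModuliPair a b) (h' : ModuliPair c d)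
    (habcd : a * b * c * d ≤ 0) : parSum a b * parSum c d ≤ 0 := by
  rcases h with ⟨rfl, rfl⟩ | h
  · simp [parSum]
  rcases h' with ⟨rfl, rfl⟩ | h'
  · simp [parSum]
  rw [parSum, parSum, div_mul_div_comm]
  exact div_nonpos_of_nonpos_of_nonneg (by linarith) (mul_pos h h').le

lemma ModuliCondition.moduliPair {n m : ℕ} {L : Matrix (Fin m) (Fin n) ℝ} {μA μB ρA ρB : ℝ}
    (h : ModuliCondition L μA μB ρA ρB) : ModuliPair μA μB ∧ ModuliPair ρA ρB := by
  rcases h with h | h | h | h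
  · exact ⟨Or.inl ⟨h.1, h.2.1⟩, Or.inl h.2.2⟩
  · exact ⟨Or.inr h.1, Or.inl h.2⟩
  · exact ⟨Or.inl h.2, Or.inr h.1⟩
  · exact ⟨Or.inr h.1, Or.inr h.2.1⟩

lemma StepsizeRule.le {n m : ℕ} {L : Matrix (Fin m) (Fin n) ℝ} {μA μB ρA ρB γ τ : ℝ}
    (h : StepsizeRule L μA μB ρA ρB γ τ) : τ ≤ 1 / (γ * ‖L‖ ^ 2) := by
  rcases h with h | h | h | h | h | h
  · exact h.2.2.2.2
  · exact h.2.2.2.2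
  · exact h.2.2.2.2
  · exact h.2.2.2.2
  · exact h.2.2.2.2
  · exact h.2.2.2.2

/-- This bound makes the preconditioner positive semidefinite. -/
lemma StepsizeRule.mul_le_one {n m : ℕ} {L : Matrix (Fin m) (Fin n) ℝ} {μA μB ρA ρB γ τ : ℝ}
    (h : StepsizeRule L μA μB ρA ρB γ τ) (hL : L ≠ 0) (hγ : 0 < γ) : γ * τ * ‖L‖ ^ 2 ≤ 1 := by
  have hle := h.le
  have hLpos := norm_pos_iff.2 hL
  rw [le_div_iff₀ (by positivity)] at hle
  linarith

/-! ### Bounds on the relaxation parameter -/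

section EtaBar

variable {n m : ℕ} {L : Matrix (Fin m) (Fin n) ℝ} {μA μB ρA ρB γ τ : ℝ}

/-- As t is real, the minimum taken in `EReal` is never ⊤, even when η' is, so `toReal` loses
nothing. -/
lemma minEtaPrime_le (t : ℝ) :
    minEtaPrime L μB ρA γ τ t ≤ t ∧
      (L.rank ≠ n → minEtaPrime L μB ρA γ τ t ≤ 1 + ρA / γ) ∧
      (L.rank ≠ m → minEtaPrime L μB ρA γ τ t ≤ 1 + μB / τ) := by
  have hmin : ∀ a b : ℝ, (min (a : EReal) (b : EReal)).toReal = min a b := fun a b => by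
    rw [← EReal.coe_strictMono.monotone.map_min, EReal.toReal_coe]
  unfold minEtaPrime etaPrime
  split_ifs with h1 h2 h2
  · rw [min_eq_left le_top, EReal.toReal_coe]
    exact ⟨le_rfl, fun h => absurd h2 h, fun h => absurd h1 h⟩
  · rw [hmin]
    exact ⟨min_le_left _ _, fun _ => min_le_right _ _, fun h => absurd h1 h⟩
  · rw [hmin]
    exact ⟨min_le_left _ _, fun h => absurd h2 h, fun _ => min_le_right _ _⟩
  · rw [hmin]
    exact ⟨min_le_left _ _, fun _ => (min_le_right _ _).trans (min_le_left _ _),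
      fun _ => (min_le_right _ _).trans (min_le_right _ _)⟩

lemma theta_mono (h : 0 ≤ parSum μA μB * parSum ρA ρB) {s t : ℝ} (hs : 0 ≤ s) (hst : s ≤ t) :
    theta μA μB ρA ρB γ τ s ≤ theta μA μB ρA ρB γ τ t := by
  have : s ^ 2 ≤ t ^ 2 := pow_le_pow_left₀ hs hst 2
  exact Real.sqrt_le_sqrt (by nlinarith)

lemma theta_anti (h : parSum μA μB * parSum ρA ρB ≤ 0) {s t : ℝ} (hs : 0 ≤ s) (hst : s ≤ t) :
    theta μA μB ρA ρB γ τ t ≤ theta μA μB ρA ρB γ τ s := by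
  have : s ^ 2 ≤ t ^ 2 := pow_le_pow_left₀ hs hst 2
  exact Real.sqrt_le_sqrt (by nlinarith)

/-- For moduli of equal sign θ dominates the absolute half-difference, and half-sum minus absolute
half-difference is the smaller of the two numbers. This yields the kernel bounds where η' is absent
from the table. -/
lemma bigDelta_sub_theta_le (h : 0 ≤ parSum μA μB * parSum ρA ρB) (s : ℝ) :
    bigDelta μA μB ρA ρB γ τ - theta μA μB ρA ρB γ τ s ≤ parSum ρA ρB / γ ∧
      bigDelta μA μB ρA ρB γ τ - theta μA μB ρA ρB γ τ s ≤ parSum μA μB / τ := by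
  have hθ : |parSum ρA ρB / (2 * γ) - parSum μA μB / (2 * τ)| ≤ theta μA μB ρA ρB γ τ s := by
    refine Real.abs_le_sqrt ?_
    nlinarith [mul_nonneg h (sq_nonneg s)]
  have e1 : parSum ρA ρB / γ = 2 * (parSum ρA ρB / (2 * γ)) := by
    rw [mul_comm 2 γ, ← div_div]; ring
  have e2 : parSum μA μB / τ = 2 * (parSum μA μB / (2 * τ)) := by
    rw [mul_comm 2 τ, ← div_div]; ring
  rw [bigDelta, e1, e2]
  constructor <;> linarith [abs_le.1 hθ]

lemma two_bigDelta : 2 * bigDelta μA μB ρA ρB γ τ = parSum ρA ρB / γ + parSum μA μB / τ := by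
  rw [bigDelta, mul_comm 2 γ, mul_comm 2 τ, ← div_div, ← div_div]
  ring

/-- At the critical stepsize the extra term completes the squared difference to the squared sum. -/
lemma theta_eq_abs_bigDelta (hγ : 0 < γ) (hτ : 0 < τ) {s : ℝ} (hs : γ * τ * s ^ 2 = 1) :
    theta μA μB ρA ρB γ τ s = |bigDelta μA μB ρA ρB γ τ| := by
  rw [theta, bigDelta, ← Real.sqrt_sq_eq_abs]
  congr 1
  have : s ^ 2 = 1 / (γ * τ) := by field_simp; linarith
  rw [this]
  field_simp
  ring

/-- The relaxation bound `η̄` is compatible with every singular value and with the kernels. -/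
theorem etaBar_bounds (hγ : 0 < γ) (hτ : 0 < τ) (hL : L ≠ 0) (hγτ : τ ≤ 1 / (γ * ‖L‖ ^ 2))
    (hμ : ModuliPair μA μB) (hρ : ModuliPair ρA ρB)
    (hle : ∀ s ∈ posSingularValues L, s ≤ ‖L‖)
    (hone : numSingularValues L = 1 → ∀ s ∈ posSingularValues L, s = ‖L‖) :
    (∀ s ∈ posSingularValues L,
      γ * τ * s ^ 2 = 1 ∧ etaBar L μA μB ρA ρB γ τ ≤ 1 + 2 * bigDelta μA μB ρA ρB γ τ ∨
      etaBar L μA μB ρA ρB γ τ ≤ 1 + bigDelta μA μB ρA ρB γ τ - theta μA μB ρA ρB γ τ s) ∧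
    (L.rank ≠ n → etaBar L μA μB ρA ρB γ τ ≤ 1 + ρA / γ) ∧
    (L.rank ≠ m → etaBar L μA μB ρA ρB γ τ ≤ 1 + μB / τ) := by
  have hLpos : 0 < ‖L‖ := norm_pos_iff.2 hL
  have hP : parSum ρA ρB / γ ≤ ρA / γ := div_le_div_of_nonneg_right (parSum_le_left hρ) hγ.le
  have hD : parSum μA μB / τ ≤ μB / τ := div_le_div_of_nonneg_right (parSum_le_right hμ) hτ.le
  have hmin : ∀ s ∈ posSingularValues L, sigmaMin L ≤ s ∧ 0 ≤ sigmaMin L := fun s hs =>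
    ⟨csInf_le ⟨0, fun t ht => ht.1.le⟩ hs, Real.sInf_nonneg fun t ht => ht.1.le⟩
  have h4 : μA * μB * ρA * ρB = (μA * μB) * (ρA * ρB) := by ring
  unfold etaBar
  split_ifs with h1 h2 h3 h5 h6 h7
  -- The sign of the product of parallel sums decides whether θ increases or decreases in σ, hence
  -- whether the worst singular value is the largest or the smallest.
  · have hprod := parSum_mul_parSum_nonneg hμ hρ h2
    have hb := bigDelta_sub_theta_le (γ := γ) (τ := τ) hprod ‖L‖
    exact ⟨fun s hs => Or.inr (by linarith [theta_mono (γ := γ) (τ := τ) hprod hs.1.le (hle s hs)]),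
      fun _ => by linarith, fun _ => by linarith⟩
  · have hprod := parSum_mul_parSum_nonpos hμ hρ (not_le.1 h2).le
    obtain ⟨k1, k2, k3⟩ := minEtaPrime_le (L := L) (μB := μB) (ρA := ρA) (γ := γ) (τ := τ)
      (1 + bigDelta μA μB ρA ρB γ τ - theta μA μB ρA ρB γ τ (sigmaMin L))
    refine ⟨fun s hs => Or.inr (k1.trans ?_), k2, k3⟩
    linarith [theta_anti (γ := γ) (τ := τ) hprod (hmin s hs).2 (hmin s hs).1]
  all_goals
    have hcrit : γ * τ * ‖L‖ ^ 2 = 1 := by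
      apply le_antisymm
      · rw [le_div_iff₀ (by positivity)] at hγτ
        linarith
      · rw [not_lt, div_le_iff₀ (by positivity)] at h1
        exact h1
  · have kP := parSum_nonpos hρ ((le_max_right _ _).trans h5)
    have kD := parSum_nonpos hμ ((le_max_left _ _).trans h5)
    have kP' := div_nonpos_of_nonpos_of_nonneg kP hγ.le
    have kD' := div_nonpos_of_nonpos_of_nonneg kD hτ.le
    rw [two_bigDelta]
    exact ⟨fun s hs => Or.inl ⟨by rw [hone h3 s hs, hcrit], le_rfl⟩, fun _ => by linarith,
      fun _ => by linarith⟩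
  · obtain ⟨k1, k2, k3⟩ := minEtaPrime_le (L := L) (μB := μB) (ρA := ρA) (γ := γ) (τ := τ)
      (1 + 2 * bigDelta μA μB ρA ρB γ τ)
    exact ⟨fun s hs => Or.inl ⟨by rw [hone h3 s hs, hcrit], k1⟩, k2, k3⟩
  · have kP := parSum_nonpos hρ ((le_max_right _ _).trans h6)
    have kD := parSum_nonpos hμ ((le_max_left _ _).trans h6)
    have kP' := div_nonpos_of_nonpos_of_nonneg kP hγ.le
    have kD' := div_nonpos_of_nonpos_of_nonneg kD hτ.le
    have e := two_bigDelta (μA := μA) (μB := μB) (ρA := ρA) (ρB := ρB) (γ := γ) (τ := τ)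
    have habs := abs_of_nonpos (show bigDelta μA μB ρA ρB γ τ ≤ 0 by linarith)
    refine ⟨fun s hs => Or.inr ?_, fun _ => by linarith, fun _ => by linarith⟩
    -- Here Δ ≤ 0, so θ(‖L‖) = -Δ and 1 + Δ - θ(‖L‖) is exactly 1 + 2Δ.
    have := theta_mono (γ := γ) (τ := τ) (mul_nonneg_of_nonpos_of_nonpos kD kP) hs.1.le (hle s hs)
    rw [theta_eq_abs_bigDelta hγ hτ hcrit, habs] at this
    linarith
  · have kD := parSum_nonneg hμ (lt_min_iff.1 h7).1.le
    have kP := parSum_nonneg hρ (lt_min_iff.1 h7).2.le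
    have hprod := mul_nonneg kD kP
    have hb := bigDelta_sub_theta_le (γ := γ) (τ := τ) hprod (sigmaTwo L)
    refine ⟨fun s hs => ?_, fun _ => by linarith, fun _ => by linarith⟩
    -- At σ = ‖L‖ the block degenerates and only 1 + 2Δ is needed; the remaining singular values are
    -- at most σ₂.
    rcases (hle s hs).eq_or_lt with heq | hlt
    · refine Or.inl ⟨by rw [heq, hcrit], ?_⟩
      rw [two_bigDelta]
      linarith [div_nonneg kD hτ.le]
    · refine Or.inr ?_
      have : s ≤ sigmaTwo L := le_csSup ⟨‖L‖, fun t ht => ht.2.le⟩ ⟨hs, hlt⟩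
      linarith [theta_mono (γ := γ) (τ := τ) hprod hs.1.le this]
  · obtain ⟨k1, k2, k3⟩ := minEtaPrime_le (L := L) (μB := μB) (ρA := ρA) (γ := γ) (τ := τ)
      (1 + bigDelta μA μB ρA ρB γ τ - theta μA μB ρA ρB γ τ (sigmaMin L))
    have hprod : parSum μA μB * parSum ρA ρB ≤ 0 := by
      refine parSum_mul_parSum_nonpos hμ hρ ?_
      rw [h4]
      rw [not_le, lt_max_iff] at h6
      rw [not_lt, min_le_iff] at h7
      rcases h6 with h6 | h6 <;> rcases h7 with h7 | h7
      · linarith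
      · exact mul_nonpos_of_nonneg_of_nonpos h6.le h7
      · exact mul_nonpos_of_nonpos_of_nonneg h7 h6.le
      · linarith
    refine ⟨fun s hs => Or.inr (k1.trans ?_), k2, k3⟩
    linarith [theta_anti (γ := γ) (τ := τ) hprod (hmin s hs).2 (hmin s hs).1]

end EtaBar

/-! ### The spectral estimate -/

section Spectral

variable {μA μB ρA ρB γ τ : ℝ}

/-- The contribution of one singular value. The free coordinates x and y drop out through
`parSum_mul_sq_le`, since the two μ-terms, and likewise the two ρ-terms, have arguments with a
difference independent of them. The rest is γ⁻¹ times `block_nonneg` with κ = γτσ² and w = t / τ. -/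
lemma scalar_bound (hγ : 0 < γ) (hτ : 0 < τ) (hμ : ModuliPair μA μB) (hρ : ModuliPair ρA ρB)
    {σ c : ℝ} (hσ : γ * τ * σ ^ 2 ≤ 1)
    (hpos : γ * τ * σ ^ 2 = 1 ∧ c ≤ 2 * bigDelta μA μB ρA ρB γ τ ∨
      c ≤ bigDelta μA μB ρA ρB γ τ - theta μA μB ρA ρB γ τ σ) (a t x y : ℝ) :
    c * (a * (a / γ - σ ^ 2 * t) + σ ^ 2 * (t * (t / τ - a))) ≤
      μA * (σ ^ 2 * x ^ 2) + ρA * (a / γ - σ ^ 2 * t - σ ^ 2 * y) ^ 2 +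
        μB * (σ ^ 2 * (t / τ - a + x) ^ 2) + ρB * (σ ^ 2 * y) ^ 2 := by
  have h1 := mul_le_mul_of_nonneg_left (parSum_mul_sq_le hμ x (t / τ - a + x)) (sq_nonneg σ)
  have h2 := parSum_mul_sq_le hρ (a / γ - σ ^ 2 * t - σ ^ 2 * y) (-(σ ^ 2 * y))
  have h3 := block_nonneg (a := parSum ρA ρB / γ) (d := parSum μA μB / τ) (κ := γ * τ * σ ^ 2)
    (c := c) (by positivity) hσ ?_ a (t / τ)
  · have h4 := div_nonneg h3 hγ.le
    have h5 : (parSum ρA ρB / γ * (a - γ * τ * σ ^ 2 * (t / τ)) ^ 2 +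
        parSum μA μB / τ * (γ * τ * σ ^ 2) * (t / τ - a) ^ 2 -
        c * (a ^ 2 - 2 * (γ * τ * σ ^ 2) * a * (t / τ) + γ * τ * σ ^ 2 * (t / τ) ^ 2)) / γ =
        parSum ρA ρB * (a / γ - σ ^ 2 * t) ^ 2 + σ ^ 2 * (parSum μA μB * (t / τ - a) ^ 2) -
          c * (a * (a / γ - σ ^ 2 * t) + σ ^ 2 * (t * (t / τ - a))) := by
      field_simp
      ring
    rw [h5] at h4
    have e1 : t / τ - a + x - x = t / τ - a := by ring
    have e2 : (-(σ ^ 2 * y) - (a / γ - σ ^ 2 * t - σ ^ 2 * y)) ^ 2 =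
        (a / γ - σ ^ 2 * t) ^ 2 := by ring
    rw [e1] at h1
    rw [e2] at h2
    linarith
  · rw [two_bigDelta] at hpos
    rcases hpos with h | h
    · exact Or.inl h
    · refine Or.inr ?_
      have e1 : (parSum ρA ρB / γ + parSum μA μB / τ) / 2 = bigDelta μA μB ρA ρB γ τ := by
        rw [← two_bigDelta]; ring
      have e2 : √(((parSum ρA ρB / γ - parSum μA μB / τ) / 2) ^ 2 +
          parSum ρA ρB / γ * (parSum μA μB / τ) * (γ * τ * σ ^ 2)) =
          theta μA μB ρA ρB γ τ σ := by
        rw [theta]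
        congr 1
        field_simp
      rw [e1, e2]
      exact h

variable {E F : Type*} [NormedAddCommGroup E] [InnerProductSpace ℝ E] [FiniteDimensional ℝ E]
  [NormedAddCommGroup F] [InnerProductSpace ℝ F] [FiniteDimensional ℝ F]

/-- Coordinates along right singular vectors. -/
lemma exists_singular_coordinates (T : E →ₗ[ℝ] F) {N : ℕ} (hN : Module.finrank ℝ E = N) :
    ∃ b : OrthonormalBasis (Fin N) ℝ E,
      (∀ p i, b.repr (LinearMap.adjoint T (T p)) i = T.singularValues i ^ 2 * b.repr p i) ∧
      (∀ p q, inner ℝ p q = ∑ i, b.repr p i * b.repr q i) ∧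
      ∀ p q, inner ℝ (T p) (T q) =
        ∑ i : Fin N, T.singularValues i ^ 2 * (b.repr p i * b.repr q i) := by
  let b := T.isSymmetric_adjoint_comp_self.eigenvectorBasis hN
  have h1 : ∀ p i, b.repr (LinearMap.adjoint T (T p)) i =
      T.singularValues i ^ 2 * b.repr p i := fun p i => by
    rw [T.sq_singularValues_fin hN]
    exact T.isSymmetric_adjoint_comp_self.eigenvectorBasis_apply_self_apply hN p i
  have h2 : ∀ p q, inner ℝ p q = ∑ i, b.repr p i * b.repr q i := fun p q => by
    rw [← b.repr.inner_map_map p q, PiLp.inner_apply]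
    simp [mul_comm]
  refine ⟨b, h1, h2, fun p q => ?_⟩
  rw [← LinearMap.adjoint_inner_left, h2]
  exact Finset.sum_congr rfl fun i _ => by rw [h1, mul_assoc]

/-- The lower bound on the semimonotonicity terms by the preconditioned seminorm. -/
theorem spectral_bound (T : E →ₗ[ℝ] F) {N : ℕ} (hN : Module.finrank ℝ E = N)
    (hγ : 0 < γ) (hτ : 0 < τ) (hμ : ModuliPair μA μB) (hρ : ModuliPair ρA ρB) {c : ℝ}
    (hle : ∀ i : Fin N, γ * τ * T.singularValues i ^ 2 ≤ 1)
    (hpos : ∀ i : Fin N, 0 < T.singularValues i →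
      γ * τ * T.singularValues i ^ 2 = 1 ∧ c ≤ 2 * bigDelta μA μB ρA ρB γ τ ∨
      c ≤ bigDelta μA μB ρA ρB γ τ - theta μA μB ρA ρB γ τ (T.singularValues i))
    (hker : ¬ Function.Injective T → c ≤ ρA / γ)
    (hcoker : ¬ Function.Surjective T → c ≤ μB / τ)
    (x α u v : E) (y β p q : F)
    (hv : v = (1 / γ) • u - LinearMap.adjoint T p) (hq : q = (1 / τ) • p - T u)
    (hα : α + LinearMap.adjoint T y = v) (hβ : β - T x = q) :
    c * (inner ℝ u v + inner ℝ p q) ≤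
      μA * ‖T x‖ ^ 2 + ρA * ‖α‖ ^ 2 + μB * ‖β‖ ^ 2 + ρB * ‖LinearMap.adjoint T y‖ ^ 2 := by
  obtain ⟨b, hb1, hb2, hb3⟩ := exists_singular_coordinates T hN
  -- Pulling the range part back to E makes right singular vectors suffice; the component killed by
  -- the adjoint is treated separately.
  have hdec : ∀ w : F, ∃ t : E, ∃ k : F, w = T t + k ∧ LinearMap.adjoint T k = 0 := fun w => by
    obtain ⟨_, ⟨t, rfl⟩, k, hk, rfl⟩ := (LinearMap.range T).exists_add_mem_mem_orthogonal w
    refine ⟨t, k, rfl, ?_⟩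
    refine ext_inner_left ℝ fun e => ?_
    rw [LinearMap.adjoint_inner_right, inner_zero_right]
    exact hk _ ⟨e, rfl⟩
  have hTk : ∀ {k : F}, LinearMap.adjoint T k = 0 → ∀ e, inner ℝ (T e) k = 0 := fun hk e => by
    rw [← LinearMap.adjoint_inner_right, hk, inner_zero_right]
  obtain ⟨t, w, rfl, hw⟩ := hdec p
  obtain ⟨y', k, rfl, hk⟩ := hdec y
  have hq' : q = T ((1 / τ) • t - u) + (1 / τ) • w := by
    rw [hq]; simp only [map_sub, map_smul, smul_add]; abel
  have hv' : v = (1 / γ) • u - LinearMap.adjoint T (T t) := by rw [hv, map_add, hw, add_zero]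
  have hα' : α = v - LinearMap.adjoint T (T y') := by
    rw [← hα, map_add, hk, add_zero, add_sub_cancel_right]
  have hβ' : β = T ((1 / τ) • t - u + x) + (1 / τ) • w := by
    rw [eq_add_of_sub_eq hβ, hq', map_add]; abel
  have n1 : inner ℝ u v = ∑ i, b.repr u i *
      (b.repr u i / γ - T.singularValues i ^ 2 * b.repr t i) := by
    rw [hb2]
    refine Finset.sum_congr rfl fun i _ => ?_
    rw [hv', map_sub, map_smul, PiLp.sub_apply, PiLp.smul_apply, hb1, smul_eq_mul]
    ring
  have n2 : inner ℝ (T t + w) q = ∑ i : Fin N, T.singularValues i ^ 2 *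
      (b.repr t i * (b.repr t i / τ - b.repr u i)) + 1 / τ * ‖w‖ ^ 2 := by
    rw [hq', inner_add_left, inner_add_right, inner_add_right, inner_smul_right, hTk hw,
      real_inner_comm, real_inner_comm _ w, hTk hw, inner_smul_right, real_inner_self_eq_norm_sq,
      real_inner_comm, hb3]
    simp only [mul_zero, add_zero, zero_add]
    congr 1
    refine Finset.sum_congr rfl fun i _ => ?_
    rw [map_sub, map_smul, PiLp.sub_apply, PiLp.smul_apply, smul_eq_mul]
    ring
  have n3 : ‖T x‖ ^ 2 = ∑ i : Fin N, T.singularValues i ^ 2 * b.repr x i ^ 2 := by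
    rw [← real_inner_self_eq_norm_sq, hb3]
    simp only [sq]
  have n4 : ‖α‖ ^ 2 = ∑ i : Fin N, (b.repr u i / γ - T.singularValues i ^ 2 * b.repr t i -
      T.singularValues i ^ 2 * b.repr y' i) ^ 2 := by
    rw [← real_inner_self_eq_norm_sq, hb2]
    refine Finset.sum_congr rfl fun i _ => ?_
    rw [hα', hv', map_sub, map_sub, map_smul, PiLp.sub_apply, PiLp.sub_apply, PiLp.smul_apply,
      hb1, hb1, smul_eq_mul]
    ring
  have n5 : ‖β‖ ^ 2 = ∑ i : Fin N, T.singularValues i ^ 2 *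
      (b.repr t i / τ - b.repr u i + b.repr x i) ^ 2 + 1 / τ ^ 2 * ‖w‖ ^ 2 := by
    rw [hβ', norm_add_sq_real, inner_smul_right, hTk hw, ← real_inner_self_eq_norm_sq, hb3,
      norm_smul, mul_pow, Real.norm_eq_abs, sq_abs]
    simp only [mul_zero, add_zero, one_div, inv_pow]
    congr 1
    refine Finset.sum_congr rfl fun i _ => ?_
    rw [map_add, map_sub, map_smul, PiLp.add_apply, PiLp.sub_apply, PiLp.smul_apply, smul_eq_mul]
    ring
  have n6 : ‖LinearMap.adjoint T (T y' + k)‖ ^ 2 =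
      ∑ i : Fin N, (T.singularValues i ^ 2 * b.repr y' i) ^ 2 := by
    rw [map_add, hk, add_zero, ← real_inner_self_eq_norm_sq, hb2]
    exact Finset.sum_congr rfl fun i _ => by rw [hb1, ← sq]
  -- The component outside the range is seen by μB alone; if nonzero, T is not surjective.
  have hwbound : c * (1 / τ * ‖w‖ ^ 2) ≤ μB * (1 / τ ^ 2 * ‖w‖ ^ 2) := by
    rcases eq_or_ne w 0 with rfl | hw0
    · simp
    · have hc := hcoker fun hsurj => by
        obtain ⟨e, rfl⟩ := hsurj w
        exact hw0 (inner_self_eq_zero.1 (hTk hw e))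
      have := mul_le_mul_of_nonneg_right hc (show 0 ≤ 1 / τ * ‖w‖ ^ 2 by positivity)
      exact this.trans_eq (by field_simp)
  have hsum := Finset.sum_le_sum fun (i : Fin N) (_ : i ∈ Finset.univ) =>
    show c * (b.repr u i * (b.repr u i / γ - T.singularValues i ^ 2 * b.repr t i) +
        T.singularValues i ^ 2 * (b.repr t i * (b.repr t i / τ - b.repr u i))) ≤
      μA * (T.singularValues i ^ 2 * b.repr x i ^ 2) +
        ρA * (b.repr u i / γ - T.singularValues i ^ 2 * b.repr t i -
          T.singularValues i ^ 2 * b.repr y' i) ^ 2 +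
        μB * (T.singularValues i ^ 2 * (b.repr t i / τ - b.repr u i + b.repr x i) ^ 2) +
        ρB * (T.singularValues i ^ 2 * b.repr y' i) ^ 2 by
    rcases (T.singularValues_nonneg i).eq_or_lt with h0 | h0
    -- A zero singular value puts `b i` in the kernel, where only the ρA term survives.
    · have hc := hker fun hinj => by
        have hi : T (b i) = 0 := by
          rw [← inner_self_eq_zero (𝕜 := ℝ), hb3, Finset.sum_eq_zero]
          intro j _
          rcases eq_or_ne j i with rfl | hj
          · rw [← h0]; ring
          · rw [b.repr_self, PiLp.single_apply, if_neg hj]; ring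
        exact b.toBasis.ne_zero i (by simpa using hinj (hi.trans (map_zero T).symm))
      rw [← h0]
      have := mul_le_mul_of_nonneg_right hc (show 0 ≤ b.repr u i ^ 2 / γ by positivity)
      calc _ = c * (b.repr u i ^ 2 / γ) := by ring
        _ ≤ ρA / γ * (b.repr u i ^ 2 / γ) := this
        _ = _ := by ring
    · exact scalar_bound hγ hτ hμ hρ (hle i) (hpos i h0) _ _ _ _
  simp only [Finset.sum_add_distrib, ← Finset.mul_sum] at hsum
  rw [n1, n2, n3, n4, n5, n6]
  linarith

end Spectral

/-! ### Fejér monotonicity in a degenerate metric -/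

section Fejer

lemma tendsto_zero_of_le_contraction {d e : ℕ → ℝ} {ε : ℝ} (hε : 0 < ε) (hε1 : ε ≤ 1)
    (hd : ∀ k, 0 ≤ d k) (h : ∀ k, d (k + 1) ≤ (1 - ε) * d k + e k)
    (he : Tendsto e atTop (𝓝 0)) : Tendsto d atTop (𝓝 0) := by
  rw [Metric.tendsto_atTop]
  intro δ hδ
  obtain ⟨K, hK⟩ := eventually_atTop.1
    (he.eventually_lt_const (show 0 < ε * (δ / 2) by positivity))
  -- δ / 2 is the fixed point of t ↦ (1 - ε)t + εδ / 2.
  have hind : ∀ j, d (K + j) ≤ δ / 2 + (1 - ε) ^ j * d K := fun j => by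
    induction j with
    | zero => simp only [add_zero, pow_zero, one_mul]; linarith
    | succ j ih =>
      have h1 := h (K + j)
      have h2 := hK (K + j) (Nat.le_add_right _ _)
      have h3 := mul_le_mul_of_nonneg_left ih (sub_nonneg.2 hε1)
      rw [← add_assoc, pow_succ]
      linarith
  have hpow : Tendsto (fun j => (1 - ε) ^ j * d K) atTop (𝓝 0) := by
    simpa using (tendsto_pow_atTop_nhds_zero_of_lt_one (sub_nonneg.2 hε1)
      (sub_lt_self 1 hε)).mul_const (d K)
  obtain ⟨J, hJ⟩ := eventually_atTop.1 (hpow.eventually_lt_const (half_pos hδ))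
  refine ⟨K + J, fun k hk => ?_⟩
  obtain ⟨j, rfl⟩ := Nat.exists_eq_add_of_le ((Nat.le_add_right K J).trans hk)
  rw [Real.dist_eq, sub_zero, abs_of_nonneg (hd _)]
  linarith [hind j, hJ j (by omega)]

variable {V : Type*} [NormedAddCommGroup V] [InnerProductSpace ℝ V]

/-- The error of z contracts by |1 - λ| ≤ 1 - ε, up to a perturbation of at most twice the error of
z̄. -/
lemma tendsto_of_relaxed_step {z zb : ℕ → V} {lam : ℕ → ℝ}
    (hz : ∀ k, z (k + 1) = z k + lam k • (zb k - z k)) {ε : ℝ} (hε : 0 < ε)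
    (hlam : ∀ k, lam k ∈ Set.Icc ε (2 - ε)) {p : V} (hzb : Tendsto zb atTop (𝓝 p)) :
    Tendsto z atTop (𝓝 p) := by
  rw [tendsto_iff_norm_sub_tendsto_zero] at hzb ⊢
  have hε1 : ε ≤ 1 := by linarith [(hlam 0).1.trans (hlam 0).2]
  refine tendsto_zero_of_le_contraction hε hε1 (fun k => norm_nonneg _) (fun k => ?_)
    (by simpa using hzb.const_mul 2)
  have e : z (k + 1) - p = (1 - lam k) • (z k - p) + lam k • (zb k - p) := by
    rw [hz]; module
  rw [e]
  have h1 : |1 - lam k| ≤ 1 - ε := abs_le.2 ⟨by linarith [(hlam k).2], by linarith [(hlam k).1]⟩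
  have h2 : |lam k| ≤ 2 := abs_le.2 ⟨by linarith [(hlam k).1], by linarith [(hlam k).2]⟩
  refine (norm_add_le _ _).trans ?_
  rw [norm_smul, norm_smul, Real.norm_eq_abs, Real.norm_eq_abs]
  gcongr

/-! ### Descent of the P-seminorm. -/

variable {P : V →ₗ[ℝ] V} {C η : ℝ} {lam : ℕ → ℝ} {z zb : ℕ → V}

/-- Expand the square: the cross term ⟨a - w, P(a - b)⟩ equals ⟨b - w, P(a - b)⟩ + ‖a - b‖_P², which
is at least c‖a - b‖_P². -/
lemma seminorm_step (hP : P.IsSymmetric) {c : ℝ} (a b w : V) (l : ℝ)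
    (h : (c - 1) * inner ℝ (a - b) (P (a - b)) ≤ inner ℝ (b - w) (P (a - b))) (hl : 0 ≤ l) :
    inner ℝ (a + l • (b - a) - w) (P (a + l • (b - a) - w)) +
      l * (2 * c - l) * inner ℝ (a - b) (P (a - b)) ≤ inner ℝ (a - w) (P (a - w)) := by
  have e1 : a + l • (b - a) - w = (a - w) - l • (a - b) := by module
  have e2 : inner ℝ (a - b) (P (a - w)) = inner ℝ (a - w) (P (a - b)) := by
    rw [real_inner_comm, hP]
  have e3 : inner ℝ (b - w) (P (a - b)) =
      inner ℝ (a - w) (P (a - b)) - inner ℝ (a - b) (P (a - b)) := by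
    rw [← inner_sub_left]; congr 1; abel
  rw [e3] at h
  rw [e1, map_sub, map_smul, inner_sub_left, inner_sub_right, inner_sub_right, inner_smul_left,
    inner_smul_left, inner_smul_right, inner_smul_right, e2]
  simp only [conj_trivial]
  nlinarith [mul_le_mul_of_nonneg_left h hl]

lemma seminorm_antitone (hP : P.IsSymmetric) (hPC : ∀ u, ‖P u‖ ^ 2 ≤ C * inner ℝ u (P u))
    (hC : 0 < C) (hz : ∀ k, z (k + 1) = z k + lam k • (zb k - z k))
    (hlam : ∀ k, lam k ∈ Set.Ioo 0 (2 * η)) {w : V}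
    (hw : ∀ k, (η - 1) * inner ℝ (z k - zb k) (P (z k - zb k)) ≤
      inner ℝ (zb k - w) (P (z k - zb k))) :
    Antitone fun k => inner ℝ (z k - w) (P (z k - w)) := by
  refine antitone_nat_of_succ_le fun k => ?_
  have h := seminorm_step hP _ _ _ (lam k) (hw k) (hlam k).1.le
  have h0 : 0 ≤ inner ℝ (z k - zb k) (P (z k - zb k)) :=
    nonneg_of_mul_nonneg_right ((sq_nonneg _).trans (hPC _)) hC
  have := mul_nonneg (mul_pos (hlam k).1 (sub_pos.2 (hlam k).2)).le h0
  rw [hz]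
  linarith

/-- Eventually λ(2η - λ) exceeds a fixed c > 0, so ‖z - z̄‖_P² is bounded by a multiple of
consecutive differences of a convergent monotone sequence. -/
lemma residual_tendsto_zero (hP : P.IsSymmetric) (hPC : ∀ u, ‖P u‖ ^ 2 ≤ C * inner ℝ u (P u))
    (hC : 0 < C) (hz : ∀ k, z (k + 1) = z k + lam k • (zb k - z k))
    (hlam : ∀ k, lam k ∈ Set.Ioo 0 (2 * η))
    (hlim : 0 < liminf (fun k => lam k * (2 * η - lam k)) atTop) {w : V}
    (hw : ∀ k, (η - 1) * inner ℝ (z k - zb k) (P (z k - zb k)) ≤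
      inner ℝ (zb k - w) (P (z k - zb k))) :
    Tendsto (fun k => P (z k - zb k)) atTop (𝓝 0) := by
  have hq0 : ∀ u, 0 ≤ inner ℝ u (P u) := fun u =>
    nonneg_of_mul_nonneg_right ((sq_nonneg _).trans (hPC _)) hC
  obtain ⟨c, hc0, hc⟩ := exists_between hlim
  have hev : ∀ᶠ k in atTop, c < lam k * (2 * η - lam k) :=
    eventually_lt_of_lt_liminf hc (isBoundedUnder_of ⟨0, fun k =>
      (mul_pos (hlam k).1 (sub_pos.2 (hlam k).2)).le⟩)
  have hconv := tendsto_atTop_ciInf (seminorm_antitone hP hPC hC hz hlam hw)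
    ⟨0, by rintro _ ⟨k, rfl⟩; exact hq0 _⟩
  have hdiff := (hconv.sub (hconv.comp (tendsto_add_atTop_nat 1))).const_mul (C / c)
  rw [sub_self, mul_zero] at hdiff
  have hsq : Tendsto (fun k => ‖P (z k - zb k)‖ ^ 2) atTop (𝓝 0) := by
    refine squeeze_zero' (Eventually.of_forall fun k => sq_nonneg _) ?_ hdiff
    filter_upwards [hev] with k hk
    have h := seminorm_step hP _ _ _ (lam k) (hw k) (hlam k).1.le
    have h1 := mul_le_mul_of_nonneg_right hk.le (hq0 (z k - zb k))
    have h2 : c * inner ℝ (z k - zb k) (P (z k - zb k)) ≤ inner ℝ (z k - w) (P (z k - w)) -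
        inner ℝ (z (k + 1) - w) (P (z (k + 1) - w)) := by
      rw [hz]; linarith
    refine (hPC _).trans ?_
    rw [div_mul_eq_mul_div, le_div_iff₀ hc0]
    calc _ = C * (c * inner ℝ (z k - zb k) (P (z k - zb k))) := by ring
      _ ≤ _ := mul_le_mul_of_nonneg_left h2 hC.le
  rw [tendsto_zero_iff_norm_tendsto_zero]
  have := hsq.sqrt
  simpa [Real.sqrt_sq] using this

lemma isBounded_range_apply
    (hPC : ∀ u, ‖P u‖ ^ 2 ≤ C * inner ℝ u (P u)) (hC : 0 < C) {w : V}
    (hanti : Antitone fun k => inner ℝ (z k - w) (P (z k - w))) :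
    Bornology.IsBounded (Set.range fun k => P (z k)) := by
  refine isBounded_iff_forall_norm_le.2
    ⟨√(C * inner ℝ (z 0 - w) (P (z 0 - w))) + ‖P w‖, ?_⟩
  rintro _ ⟨k, rfl⟩
  have h1 : ‖P (z k - w)‖ ≤ √(C * inner ℝ (z 0 - w) (P (z 0 - w))) :=
    Real.le_sqrt_of_sq_le ((hPC _).trans (mul_le_mul_of_nonneg_left (hanti (Nat.zero_le k)) hC.le))
  calc ‖P (z k)‖ = ‖P (z k - w) + P w‖ := by rw [map_sub, sub_add_cancel]
    _ ≤ _ := (norm_add_le _ _).trans (by gcongr)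

/-! ### Projection onto the range of P, and limits of the iterates. -/

variable [FiniteDimensional ℝ V]

lemma apply_starProjection_range (hP : P.IsSymmetric) (u : V) :
    P ((LinearMap.range P).starProjection u) = P u := by
  have h : u - (LinearMap.range P).starProjection u ∈ (LinearMap.range P)ᗮ :=
    Submodule.sub_starProjection_mem_orthogonal u
  have h2 : P (u - (LinearMap.range P).starProjection u) = 0 :=
    ext_inner_left ℝ fun e => by
      rw [← hP, inner_zero_right]
      exact h _ ⟨e, rfl⟩
  rw [map_sub, sub_eq_zero] at h2
  exact h2.symm

/-- The projection onto the range of a symmetric map factors through the map. -/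
lemma exists_comp_eq_starProjection_range (hP : P.IsSymmetric) :
    ∃ G : V →L[ℝ] V, ∀ u, G (P u) = (LinearMap.range P).starProjection u := by
  obtain ⟨H, hH⟩ := P.rangeRestrict.exists_rightInverse_of_surjective P.range_rangeRestrict
  have hH' : ∀ w : LinearMap.range P, P (H w) = w := fun w =>
    congrArg Subtype.val (LinearMap.congr_fun hH w)
  refine ⟨(LinearMap.range P).starProjection ∘L H.toContinuousLinearMap ∘L
    (LinearMap.range P).orthogonalProjectionOnto, fun u => ?_⟩
  have e : (LinearMap.range P).orthogonalProjectionOnto (P u) = ⟨P u, ⟨u, rfl⟩⟩ :=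
    Submodule.orthogonalProjectionOnto_mem_subspace_eq_self
      (⟨P u, ⟨u, rfl⟩⟩ : LinearMap.range P)
  simp only [ContinuousLinearMap.comp_apply, e]
  rw [← sub_eq_zero, ← map_sub, Submodule.starProjection_apply_eq_zero_iff,
    Submodule.mem_orthogonal]
  rintro _ ⟨v, rfl⟩
  rw [hP, map_sub]
  have := hH' ⟨P u, ⟨u, rfl⟩⟩
  simp only [LinearMap.coe_toContinuousLinearMap'] at this ⊢
  rw [this, sub_self, inner_zero_right]

/-- Boundedness of the projected sequences. -/
lemma isBounded_range_starProjection (hP : P.IsSymmetric)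
    (h : Bornology.IsBounded (Set.range fun k => P (z k))) :
    Bornology.IsBounded (Set.range fun k => (LinearMap.range P).starProjection (z k)) := by
  obtain ⟨G, hG⟩ := exists_comp_eq_starProjection_range hP
  have := G.lipschitz.isBounded_image h
  rw [← Set.range_comp] at this
  simpa only [Function.comp_def, hG] using this

/-- Limit points of the projected sequence, when the iteration depends continuously on `P z`. -/
lemma clusterPt_mem_image (hP : P.IsSymmetric)
    (hres : Tendsto (fun k => P (z k - zb k)) atTop (𝓝 0)) {Z : Set V}
    (hZ : ∀ p, MapClusterPt p atTop zb → p ∈ Z) {f : V → V} (hf : Continuous f)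
    (hzb : ∀ k, zb k = f (P (z k))) {p : V}
    (hp : MapClusterPt p atTop fun k => (LinearMap.range P).starProjection (z k)) :
    f (P p) ∈ Z ∧ (LinearMap.range P).starProjection (f (P p)) = p := by
  obtain ⟨G, hG⟩ := exists_comp_eq_starProjection_range hP
  obtain ⟨ψ, hψ, hlim⟩ := hp.tendsto_subseq
  have hPlim : Tendsto (fun k => P (z (ψ k))) atTop (𝓝 (P p)) := by
    have := (P.continuous_of_finiteDimensional.tendsto p).comp hlim
    simpa only [Function.comp_def, apply_starProjection_range hP] using this
  have hzlim : Tendsto (fun k => zb (ψ k)) atTop (𝓝 (f (P p))) := by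
    simpa only [Function.comp_def, hzb] using (hf.tendsto (P p)).comp hPlim
  refine ⟨hZ _ (MapClusterPt.of_comp hψ.tendsto_atTop hzlim.mapClusterPt), ?_⟩
  -- The projection is a continuous function of P, so the vanishing residual makes the projections
  -- of z and z̄ share their limit.
  have h1 := ((LinearMap.range P).starProjection.continuous.tendsto _).comp hzlim
  have h2 : Tendsto (fun k => G (P (z (ψ k) - zb (ψ k)))) atTop (𝓝 0) := by
    simpa only [map_zero, Function.comp_def] using
      (G.continuous.tendsto 0).comp (hres.comp hψ.tendsto_atTop)
  have h3 := hlim.sub h2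
  rw [sub_zero] at h3
  refine tendsto_nhds_unique h1 (h3.congr fun k => ?_)
  simp only [Function.comp_apply, hG, map_sub, sub_sub_cancel]

/-- Convergence when the seminorm distance to every zero is nonincreasing. -/
lemma exists_tendsto_of_antitone (hP : P.IsSymmetric)
    (hPC : ∀ u, ‖P u‖ ^ 2 ≤ C * inner ℝ u (P u)) (hC : 0 < C)
    (hres : Tendsto (fun k => P (z k - zb k)) atTop (𝓝 0)) {Z : Set V} (hne : Z.Nonempty)
    (hZ : ∀ p, MapClusterPt p atTop zb → p ∈ Z) {f : V → V} (hf : Continuous f)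
    (hzb : ∀ k, zb k = f (P (z k)))
    (hanti : ∀ w ∈ Z, Antitone fun k => inner ℝ (z k - w) (P (z k - w))) :
    (∃ p ∈ (LinearMap.range P).starProjection '' Z,
      Tendsto (fun k => (LinearMap.range P).starProjection (z k)) atTop (𝓝 p)) ∧
    ∃ p ∈ Z, Tendsto zb atTop (𝓝 p) := by
  obtain ⟨G, hG⟩ := exists_comp_eq_starProjection_range hP
  obtain ⟨w₀, hw₀⟩ := hne
  have hbdd := isBounded_range_starProjection hP (isBounded_range_apply hPC hC (hanti w₀ hw₀))
  obtain ⟨p, -, ψ, hψ, hlim⟩ := tendsto_subseq_of_bounded hbdd fun k => Set.mem_range_self k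
  obtain ⟨hw, hwp⟩ := clusterPt_mem_image hP hres hZ hf hzb
    (MapClusterPt.of_comp hψ.tendsto_atTop hlim.mapClusterPt)
  set w := f (P p)
  -- The seminorm depends continuously on `P u` alone, so it vanishes along the subsequence;
  -- monotonicity extends this to the whole sequence.
  have hq : ∀ u, inner ℝ u (P u) = inner ℝ (G (P u)) (P u) := fun u => by
    rw [hG, ← apply_starProjection_range hP u, ← hP, ← hP]
    simp only [apply_starProjection_range hP]
  have hPp : P w = P p := by rw [← hwp, apply_starProjection_range hP]
  have hPlim : Tendsto (fun k => P (z (ψ k) - w)) atTop (𝓝 0) := by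
    have := ((P.continuous_of_finiteDimensional.tendsto p).comp hlim).sub_const (P p)
    simpa only [Function.comp_def, apply_starProjection_range hP, sub_self, map_sub, hPp] using this
  have hqsub : Tendsto (fun k => inner ℝ (z (ψ k) - w) (P (z (ψ k) - w))) atTop (𝓝 0) := by
    have := ((G.continuous.tendsto 0).comp hPlim).inner (𝕜 := ℝ) hPlim
    rw [inner_zero_right] at this
    exact this.congr fun k => (hq _).symm
  have hqlim : Tendsto (fun k => inner ℝ (z k - w) (P (z k - w))) atTop (𝓝 0) := by
    have hconv := tendsto_atTop_ciInf (hanti w hw) ⟨0, by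
      rintro _ ⟨k, rfl⟩
      exact nonneg_of_mul_nonneg_right ((sq_nonneg _).trans (hPC _)) hC⟩
    have e := tendsto_nhds_unique (hconv.comp hψ.tendsto_atTop) hqsub
    rwa [e] at hconv
  have hP0 : Tendsto (fun k => P (z k - w)) atTop (𝓝 0) := by
    have hsq : Tendsto (fun k => ‖P (z k - w)‖ ^ 2) atTop (𝓝 0) :=
      squeeze_zero (fun k => sq_nonneg _) (fun k => hPC _) (by simpa using hqlim.const_mul C)
    rw [tendsto_zero_iff_norm_tendsto_zero]
    simpa [Real.sqrt_sq] using hsq.sqrt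
  have hPz : Tendsto (fun k => P (z k)) atTop (𝓝 (P w)) := by
    simpa only [map_sub, sub_add_cancel, zero_add] using hP0.add_const (P w)
  refine ⟨⟨p, ⟨w, hw, hwp⟩, ?_⟩, f (P w), ?_⟩
  · rw [← hwp, ← hG]
    simpa only [Function.comp_def, hG] using (G.continuous.tendsto (P w)).comp hPz
  · have hzbl : Tendsto zb atTop (𝓝 (f (P w))) := by
      simpa only [Function.comp_def, ← hzb] using (hf.tendsto (P w)).comp hPz
    exact ⟨hZ _ hzbl.mapClusterPt, hzbl⟩

end Fejer

/-! ### The preconditioner and the primal-dual operator -/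

section PrimalDual

variable {n m : ℕ} {L : Matrix (Fin m) (Fin n) ℝ} {γ τ : ℝ}

/-- The first block of a vector, as a linear map. -/
def fstBlock : Vec (Fin n ⊕ Fin m) →ₗ[ℝ] Vec (Fin n) where
  toFun z := WithLp.toLp 2 fun i => z (Sum.inl i)
  map_add' _ _ := rfl
  map_smul' _ _ := rfl

/-- The second block of a vector, as a linear map. -/
def sndBlock : Vec (Fin n ⊕ Fin m) →ₗ[ℝ] Vec (Fin m) where
  toFun z := WithLp.toLp 2 fun i => z (Sum.inr i)
  map_add' _ _ := rfl
  map_smul' _ _ := rfl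

lemma fstBlock_pair (x : Vec (Fin n)) (y : Vec (Fin m)) : fstBlock (pair x y) = x := rfl

lemma sndBlock_pair (x : Vec (Fin n)) (y : Vec (Fin m)) : sndBlock (pair x y) = y := rfl

lemma pair_blocks (z : Vec (Fin n ⊕ Fin m)) : pair (fstBlock z) (sndBlock z) = z := by
  ext i
  rcases i with i | i <;> rfl

lemma pair_sub (x x' : Vec (Fin n)) (y y' : Vec (Fin m)) :
    pair x y - pair x' y' = pair (x - x') (y - y') := by
  ext i
  rcases i with i | i <;> rfl

lemma pair_add (x x' : Vec (Fin n)) (y y' : Vec (Fin m)) :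
    pair x y + pair x' y' = pair (x + x') (y + y') := by
  ext i
  rcases i with i | i <;> rfl

lemma smul_pair (c : ℝ) (x : Vec (Fin n)) (y : Vec (Fin m)) :
    c • pair x y = pair (c • x) (c • y) := by
  ext i
  rcases i with i | i <;> rfl

lemma inner_pair (x x' : Vec (Fin n)) (y y' : Vec (Fin m)) :
    inner ℝ (pair x y) (pair x' y') = inner ℝ x x' + inner ℝ y y' := by
  simp [pair, PiLp.inner_apply, Fintype.sum_sum_type]

lemma norm_pair_sq (x : Vec (Fin n)) (y : Vec (Fin m)) :
    ‖pair x y‖ ^ 2 = ‖x‖ ^ 2 + ‖y‖ ^ 2 := by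
  simp only [← real_inner_self_eq_norm_sq, inner_pair]

lemma continuous_pair :
    Continuous fun p : Vec (Fin n) × Vec (Fin m) => pair p.1 p.2 := by
  refine (PiLp.continuous_toLp 2 _).comp (continuous_pi fun i => ?_)
  rcases i with i | i
  · exact (EuclideanSpace.proj i).continuous.comp continuous_fst
  · exact (EuclideanSpace.proj i).continuous.comp continuous_snd

lemma act_transpose (L : Matrix (Fin m) (Fin n) ℝ) (y : Vec (Fin m)) :
    act Lᵀ y = LinearMap.adjoint (Matrix.toEuclideanLin L) y := by
  rw [← Matrix.toEuclideanLin_conjTranspose_eq_adjoint,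
    Matrix.conjTranspose_eq_transpose_of_trivial]

lemma inner_act_transpose (x : Vec (Fin n)) (y : Vec (Fin m)) :
    inner ℝ x (act Lᵀ y) = inner ℝ (act L x) y := by
  rw [act_transpose, LinearMap.adjoint_inner_right]

lemma continuous_act {ι κ : Type} [Fintype ι] [DecidableEq ι] [Fintype κ] (M : Matrix κ ι ℝ) :
    Continuous (act M) :=
  (Matrix.toEuclideanLin M).continuous_of_finiteDimensional

lemma norm_act_le (x : Vec (Fin n)) : ‖act L x‖ ≤ ‖L‖ * ‖x‖ := L.l2_opNorm_mulVec x

lemma norm_act_transpose_le (y : Vec (Fin m)) : ‖act Lᵀ y‖ ≤ ‖L‖ * ‖y‖ := by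
  have h := Lᵀ.l2_opNorm_mulVec y
  rwa [← Matrix.conjTranspose_eq_transpose_of_trivial L, Matrix.l2_opNorm_conjTranspose] at h

lemma act_precond_pair (x : Vec (Fin n)) (y : Vec (Fin m)) :
    act (precond L γ τ) (pair x y) =
      pair ((1 / γ) • x - act Lᵀ y) ((1 / τ) • y - act L x) := by
  ext i
  rcases i with i | i
  · simp [act, precond, pair, Matrix.toLpLin_apply, Matrix.fromBlocks_mulVec,
      Matrix.smul_mulVec, Matrix.neg_mulVec, sub_eq_add_neg]
  · simp [act, precond, pair, Matrix.toLpLin_apply, Matrix.fromBlocks_mulVec,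
      Matrix.smul_mulVec, Matrix.neg_mulVec, sub_eq_add_neg, add_comm]

lemma isSymmetric_precond : (Matrix.toEuclideanLin (precond L γ τ)).IsSymmetric := by
  intro u v
  rw [← pair_blocks u, ← pair_blocks v]
  change inner ℝ (act _ _) _ = inner ℝ _ (act _ _)
  rw [act_precond_pair, act_precond_pair, inner_pair, inner_pair, inner_sub_left, inner_sub_left,
    inner_sub_right, inner_sub_right, inner_act_transpose, real_inner_comm _ (act Lᵀ _),
    inner_act_transpose, inner_smul_left, inner_smul_left, inner_smul_right, inner_smul_right,
    real_inner_comm (sndBlock u) (act L (fstBlock v))]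
  simp only [conj_trivial]
  ring

/-- With C = 1/γ + 1/τ the off-diagonal blocks of CP - P² cancel, leaving the diagonal blocks I/(γτ)
- LᵀL and I/(γτ) - LLᵀ, both positive semidefinite. -/
lemma norm_precond_sq_le (hγ : 0 < γ) (hτ : 0 < τ) (h : γ * τ * ‖L‖ ^ 2 ≤ 1)
    (u : Vec (Fin n ⊕ Fin m)) :
    ‖Matrix.toEuclideanLin (precond L γ τ) u‖ ^ 2 ≤
      (1 / γ + 1 / τ) * inner ℝ u (Matrix.toEuclideanLin (precond L γ τ) u) := by
  obtain ⟨x, y, rfl⟩ : ∃ x y, u = pair x y := ⟨_, _, (pair_blocks u).symm⟩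
  change ‖act _ _‖ ^ 2 ≤ _ * inner ℝ _ (act _ _)
  rw [act_precond_pair, norm_pair_sq, inner_pair, norm_sub_sq_real, norm_sub_sq_real,
    inner_sub_right, inner_sub_right, inner_smul_right, inner_smul_right, inner_smul_left,
    inner_smul_left, inner_act_transpose, real_inner_comm (act L x) y, real_inner_self_eq_norm_sq,
    real_inner_self_eq_norm_sq, norm_smul, norm_smul, mul_pow, mul_pow, Real.norm_eq_abs,
    Real.norm_eq_abs, sq_abs, sq_abs]
  simp only [conj_trivial]
  have h1 : ‖act L x‖ ^ 2 ≤ ‖L‖ ^ 2 * ‖x‖ ^ 2 := by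
    rw [← mul_pow]; exact pow_le_pow_left₀ (norm_nonneg _) (norm_act_le x) 2
  have h2 : ‖act Lᵀ y‖ ^ 2 ≤ ‖L‖ ^ 2 * ‖y‖ ^ 2 := by
    rw [← mul_pow]; exact pow_le_pow_left₀ (norm_nonneg _) (norm_act_transpose_le y) 2
  have hL2 : ‖L‖ ^ 2 ≤ 1 / γ * (1 / τ) := by
    rw [one_div_mul_one_div, le_div_iff₀ (by positivity)]
    linarith
  have h3 := mul_le_mul_of_nonneg_right hL2 (sq_nonneg ‖x‖)
  have h4 := mul_le_mul_of_nonneg_right hL2 (sq_nonneg ‖y‖)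
  nlinarith

/-! ### The algorithm as a preconditioned proximal step. -/

lemma mem_resolventOp_scale {ι : Type} {A : SetOp ι} {c : ℝ} {x u : Vec ι}
    (h : x ∈ resolventOp (scale c A) u) : ∃ a ∈ A x, u = x + c • a := by
  obtain ⟨_, ⟨a, ha, rfl⟩, h⟩ := h
  exact ⟨a, ha, h⟩

lemma outerSemicontinuous_primalDual {A : SetOp (Fin n)} {B : SetOp (Fin m)}
    (hA : OuterSemicontinuous A) (hB : OuterSemicontinuous B) :
    OuterSemicontinuous (primalDual A B L) := by
  intro z₀ u v w hu hv huv
  have hf := fun {u : ℕ → Vec (Fin n ⊕ Fin m)} {p} (h : Tendsto u atTop (𝓝 p)) =>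
    ((fstBlock (n := n) (m := m)).continuous_of_finiteDimensional.tendsto p).comp h
  have hs := fun {u : ℕ → Vec (Fin n ⊕ Fin m)} {p} (h : Tendsto u atTop (𝓝 p)) =>
    ((sndBlock (n := n) (m := m)).continuous_of_finiteDimensional.tendsto p).comp h
  have hmem : ∀ k, fstBlock (v k) - act Lᵀ (sndBlock (u k)) ∈ A (fstBlock (u k)) ∧
      sndBlock (u k) ∈ B (sndBlock (v k) + act L (fstBlock (u k))) := fun k => by
    obtain ⟨x, y, h1, a, ha, b, hb, h2⟩ := huv k
    rw [h1, h2]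
    simp only [fstBlock_pair, sndBlock_pair, add_sub_cancel_right, sub_add_cancel]
    exact ⟨ha, hb⟩
  have h1 := hA _ _ _ _ (hf hu)
    ((hf hv).sub (((continuous_act Lᵀ).tendsto _).comp (hs hu))) fun k => (hmem k).1
  have h2 := hB _ _ _ _ ((hs hv).add (((continuous_act L).tendsto _).comp (hf hu))) (hs hu)
    fun k => (hmem k).2
  exact ⟨_, _, (pair_blocks z₀).symm, _, h1, _, h2, by
    rw [sub_add_cancel, add_sub_cancel_right, pair_blocks]⟩

lemma precond_residual_mem {A : SetOp (Fin n)} {B : SetOp (Fin m)} (hγ : 0 < γ) (hτ : 0 < τ)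
    {x xb : Vec (Fin n)} {y yb : Vec (Fin m)}
    (hx : xb ∈ resolventOp (scale γ A) (x - γ • act Lᵀ y))
    (hy : yb ∈ resolventOp (scale τ (invOp B)) (y + τ • act L ((2 : ℝ) • xb - x))) :
    act (precond L γ τ) (pair x y - pair xb yb) ∈ primalDual A B L (pair xb yb) := by
  obtain ⟨a, ha, h1⟩ := mem_resolventOp_scale hx
  obtain ⟨b, hb, h2⟩ := mem_resolventOp_scale hy
  refine ⟨xb, yb, rfl, a, ha, b, hb, ?_⟩
  have e1 : a = (1 / γ) • (x - xb) - act Lᵀ y := by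
    have : a = (1 / γ) • (x - γ • act Lᵀ y - xb) := by
      rw [h1, add_sub_cancel_left, smul_smul, one_div_mul_cancel hγ.ne', one_smul]
    rw [this, sub_right_comm, smul_sub, smul_smul, one_div_mul_cancel hγ.ne', one_smul]
  have e2 : b = (1 / τ) • (y - yb) + act L ((2 : ℝ) • xb - x) := by
    have : b = (1 / τ) • (y + τ • act L ((2 : ℝ) • xb - x) - yb) := by
      rw [h2, add_sub_cancel_left, smul_smul, one_div_mul_cancel hτ.ne', one_smul]
    rw [this, add_sub_right_comm, smul_add, smul_smul, one_div_mul_cancel hτ.ne', one_smul]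
  rw [pair_sub, act_precond_pair, e1, e2]
  simp only [act, map_sub, map_smul]
  congr 1 <;> module

/-- The resolvent arguments depend on (x, y) only through (p, q) = P(x, y): they are γp and τq +
2τLx̄. -/
lemma exists_continuous_step {A : SetOp (Fin n)} {B : SetOp (Fin m)} (hγ : 0 < γ) (hτ : 0 < τ)
    (hA : SingleValuedContinuous (resolventOp (scale γ A)))
    (hB : SingleValuedContinuous (resolventOp (scale τ (invOp B)))) :
    ∃ f : Vec (Fin n ⊕ Fin m) → Vec (Fin n ⊕ Fin m), Continuous f ∧
      ∀ x xb y yb, xb ∈ resolventOp (scale γ A) (x - γ • act Lᵀ y) →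
        yb ∈ resolventOp (scale τ (invOp B)) (y + τ • act L ((2 : ℝ) • xb - x)) →
        pair xb yb = f (act (precond L γ τ) (pair x y)) := by
  obtain ⟨f, hf, hfA⟩ := hA
  obtain ⟨g, hg, hgB⟩ := hB
  have hc1 := (fstBlock (n := n) (m := m)).continuous_of_finiteDimensional
  have hc2 := (sndBlock (n := n) (m := m)).continuous_of_finiteDimensional
  have hF : Continuous fun w : Vec (Fin n ⊕ Fin m) => f (γ • fstBlock w) :=
    hf.comp (hc1.const_smul γ)
  refine ⟨fun w => pair (f (γ • fstBlock w))
    (g (τ • sndBlock w + (2 * τ) • act L (f (γ • fstBlock w)))),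
    continuous_pair.comp (hF.prodMk (hg.comp ((hc2.const_smul τ).add
      (((continuous_act L).comp hF).const_smul (2 * τ))))), fun x xb y yb hx hy => ?_⟩
  rw [hfA] at hx
  rw [hgB] at hy
  have e1 : γ • ((1 / γ) • x - act Lᵀ y) = x - γ • act Lᵀ y := by
    rw [smul_sub, smul_smul, mul_one_div_cancel hγ.ne', one_smul]
  have e2 : τ • ((1 / τ) • y - act L x) + (2 * τ) • act L xb =
      y + τ • act L ((2 : ℝ) • xb - x) := by
    rw [smul_sub, smul_smul, mul_one_div_cancel hτ.ne', one_smul]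
    simp only [act, map_sub, map_smul]
    module
  rw [act_precond_pair]
  dsimp only
  rw [fstBlock_pair, sndBlock_pair, e1, ← Set.mem_singleton_iff.1 hx, e2,
    ← Set.mem_singleton_iff.1 hy]

/-! ### Singular values, norm and rank of L. -/

lemma singularValues_le_norm {i : ℕ} :
    (Matrix.toEuclideanLin L).singularValues i ≤ ‖L‖ := by
  have hN : Module.finrank ℝ (Vec (Fin n)) = n := finrank_euclideanSpace_fin
  rcases lt_or_ge i n with hi | hi
  · obtain ⟨b, -, -, hb⟩ := exists_singular_coordinates (Matrix.toEuclideanLin L) hN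
    have h1 : ‖act L (b ⟨i, hi⟩)‖ ^ 2 = (Matrix.toEuclideanLin L).singularValues i ^ 2 := by
      rw [← real_inner_self_eq_norm_sq, hb, Finset.sum_eq_single ⟨i, hi⟩]
      · rw [b.repr_self, PiLp.single_apply, if_pos rfl]; ring
      · intro j _ hj
        rw [b.repr_self, PiLp.single_apply, if_neg hj]; ring
      · exact fun h => absurd (Finset.mem_univ _) h
    have h2 := norm_act_le (L := L) (b ⟨i, hi⟩)
    rw [b.norm_eq_one, mul_one] at h2
    refine le_of_sq_le_sq ?_ (norm_nonneg L)
    rw [← h1]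
    exact pow_le_pow_left₀ (norm_nonneg _) h2 2
  · rw [LinearMap.singularValues_of_finrank_le _ (by rwa [hN])]
    exact norm_nonneg L

lemma le_norm_of_mem_posSingularValues {s : ℝ} (hs : s ∈ posSingularValues L) : s ≤ ‖L‖ := by
  obtain ⟨-, i, rfl⟩ := hs
  exact singularValues_le_norm

lemma eq_norm_of_numSingularValues_eq_one (h : numSingularValues L = 1) {s : ℝ}
    (hs : s ∈ posSingularValues L) : s = ‖L‖ := by
  refine (le_norm_of_mem_posSingularValues hs).antisymm ?_
  obtain ⟨r, hr⟩ := Set.ncard_eq_one.1 h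
  -- Every singular value is 0 or s, so L stretches no vector by more than s.
  have hsub : ∀ i, (Matrix.toEuclideanLin L).singularValues i ≤ s := fun i => by
    rcases ((Matrix.toEuclideanLin L).singularValues_nonneg i).eq_or_lt with h0 | h0
    · rw [← h0]; exact hs.1.le
    · have hi : (Matrix.toEuclideanLin L).singularValues i ∈ posSingularValues L := ⟨h0, i, rfl⟩
      rw [hr, Set.mem_singleton_iff] at hi hs
      rw [hi, hs]
  obtain ⟨b, -, hb1, hb2⟩ := exists_singular_coordinates (Matrix.toEuclideanLin L)
    (finrank_euclideanSpace_fin (𝕜 := ℝ) (n := n))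
  rw [Matrix.l2_opNorm_def]
  refine ContinuousLinearMap.opNorm_le_bound _ hs.1.le fun x => ?_
  change ‖act L x‖ ≤ _
  refine le_of_sq_le_sq ?_ (mul_nonneg hs.1.le (norm_nonneg x))
  rw [mul_pow, ← real_inner_self_eq_norm_sq, ← real_inner_self_eq_norm_sq x, hb1, hb2,
    Finset.mul_sum]
  refine Finset.sum_le_sum fun i _ => mul_le_mul_of_nonneg_right ?_ (mul_self_nonneg _)
  exact pow_le_pow_left₀ (LinearMap.singularValues_nonneg _ _) (hsub i) 2

lemma rank_eq_finrank_range :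
    L.rank = Module.finrank ℝ (LinearMap.range (Matrix.toEuclideanLin L)) := by
  have h : Matrix.toEuclideanLin L =
      Matrix.toLin (PiLp.basisFun 2 ℝ (Fin n)) (PiLp.basisFun 2 ℝ (Fin m)) L :=
    LinearEquiv.congr_fun (Matrix.toLpLin_eq_toLin 2 2) L
  rw [h]
  exact L.rank_eq_finrank_range_toLin _ _

lemma rank_ne_of_not_injective (h : ¬ Function.Injective (Matrix.toEuclideanLin L)) :
    L.rank ≠ n := by
  intro hr
  refine h (LinearMap.ker_eq_bot.1 (Submodule.finrank_eq_zero.1 ?_))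
  have := (Matrix.toEuclideanLin L).finrank_range_add_finrank_ker
  rw [← rank_eq_finrank_range, hr, finrank_euclideanSpace_fin] at this
  omega

lemma rank_ne_of_not_surjective (h : ¬ Function.Surjective (Matrix.toEuclideanLin L)) :
    L.rank ≠ m := by
  intro hr
  refine h (LinearMap.range_eq_top.1 (Submodule.eq_top_of_finrank_eq ?_))
  rw [← rank_eq_finrank_range, hr, finrank_euclideanSpace_fin]

/-! ### Semimonotonicity forms and the weak Minty inequality. -/

lemma qform_smul_transpose_mul (c : ℝ) (x : Vec (Fin n)) :
    qform (c • (Lᵀ * L)) x = c * ‖act L x‖ ^ 2 := by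
  have e : act (c • (Lᵀ * L)) x = c • act Lᵀ (act L x) := by
    ext i
    simp [act, Matrix.toLpLin_apply]
  rw [qform, e, inner_smul_right, inner_act_transpose, real_inner_self_eq_norm_sq]

lemma qform_smul_mul_transpose (c : ℝ) (y : Vec (Fin m)) :
    qform (c • (L * Lᵀ)) y = c * ‖act Lᵀ y‖ ^ 2 := by
  have := qform_smul_transpose_mul (L := Lᵀ) c y
  rwa [Matrix.transpose_transpose] at this

lemma qform_smul_one {k : ℕ} (c : ℝ) (x : Vec (Fin k)) : qform (c • 1) x = c * ‖x‖ ^ 2 := by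
  have e : act (c • (1 : Matrix (Fin k) (Fin k) ℝ)) x = c • x := by
    ext i
    simp [act]
  rw [qform, e, inner_smul_right, real_inner_self_eq_norm_sq]

/-- The oblique weak Minty inequality for the preconditioned operator. -/
theorem weak_minty {A : SetOp (Fin n)} {B : SetOp (Fin m)} {μA μB ρA ρB : ℝ} (hL : L ≠ 0)
    (hγ : 0 < γ) (hτ : 0 < τ) (hmod : ModuliCondition L μA μB ρA ρB)
    (hstep : StepsizeRule L μA μB ρA ρB γ τ) {xs : Vec (Fin n)} {ys : Vec (Fin m)}
    (hSA : SemimonotoneAt A (μA • (Lᵀ * L)) (ρA • 1) xs (-act Lᵀ ys))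
    (hSB : SemimonotoneAt B (μB • 1) (ρB • (L * Lᵀ)) (act L xs) ys)
    {u zb : Vec (Fin n ⊕ Fin m)} (hu : act (precond L γ τ) u ∈ primalDual A B L zb) :
    (etaBar L μA μB ρA ρB γ τ - 1) * inner ℝ u (act (precond L γ τ) u) ≤
      inner ℝ (zb - pair xs ys) (act (precond L γ τ) u) := by
  obtain ⟨hμ, hρ⟩ := hmod.moduliPair
  have hle := hstep.mul_le_one hL hγ
  obtain ⟨hb1, hb2, hb3⟩ := etaBar_bounds hγ hτ hL hstep.le hμ hρ
    (fun s hs => le_norm_of_mem_posSingularValues hs)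
    (fun h s hs => eq_norm_of_numSingularValues_eq_one h hs)
  obtain ⟨u, p, rfl⟩ : ∃ x y, u = pair x y := ⟨_, _, (pair_blocks u).symm⟩
  obtain ⟨x, y, rfl, a, ha, b, hb, hab⟩ := hu
  have h1 := hSA.2 x a ha
  -- Since `b` lies in `invOp B y`, the graph point of B is (b, y).
  have h2 := hSB.2 b y hb
  rw [qform_smul_transpose_mul, qform_smul_one] at h1
  rw [qform_smul_mul_transpose, qform_smul_one] at h2
  have hab1 := congrArg fstBlock hab
  have hab2 := congrArg sndBlock hab
  rw [act_precond_pair] at hab1 hab2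
  simp only [fstBlock_pair, sndBlock_pair] at hab1 hab2
  have key := spectral_bound (Matrix.toEuclideanLin L)
    (finrank_euclideanSpace_fin (𝕜 := ℝ) (n := n)) hγ hτ hμ hρ
    (c := etaBar L μA μB ρA ρB γ τ - 1)
    (fun i => (mul_le_mul_of_nonneg_left (pow_le_pow_left₀ (LinearMap.singularValues_nonneg _ _)
      singularValues_le_norm 2) (by positivity)).trans hle)
    (fun i hi => by
      rcases hb1 _ ⟨hi, i, rfl⟩ with h | h
      · exact Or.inl ⟨h.1, by linarith [h.2]⟩
      · exact Or.inr (by linarith))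
    (fun h => by linarith [hb2 (rank_ne_of_not_injective h)])
    (fun h => by linarith [hb3 (rank_ne_of_not_surjective h)])
    (x - xs) (a - -act Lᵀ ys) u ((1 / γ) • u - act Lᵀ p) (y - ys) (b - act L xs) p
    ((1 / τ) • p - act L u) (by rw [act_transpose]) rfl
    (by rw [hab1, ← act_transpose]; simp only [act, map_sub]; abel)
    (by rw [hab2]; simp only [act, map_sub]; abel)
  rw [← act_transpose] at key
  rw [act_precond_pair, inner_pair]
  refine key.trans ?_
  rw [hab1, hab2, pair_sub, inner_pair]
  have e1 : a + act Lᵀ y = (a - -act Lᵀ ys) + act Lᵀ (y - ys) := by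
    simp only [act, map_sub]; abel
  have e2 : b - act L x = (b - act L xs) - act L (x - xs) := by
    simp only [act, map_sub]; abel
  have e3 : inner ℝ (y - ys) (act L (x - xs)) = inner ℝ (act L (x - xs)) (y - ys) :=
    real_inner_comm _ _
  have e4 : inner ℝ (b - act L xs) (y - ys) = inner ℝ (y - ys) (b - act L xs) :=
    real_inner_comm _ _
  -- The skew coupling terms are now equal with opposite signs and cancel in the sum.
  rw [e1, e2, inner_add_right, inner_act_transpose, inner_sub_right (y - ys), e3]
  rw [e4] at h2
  change μA * ‖act L (x - xs)‖ ^ 2 + _ + _ + _ ≤ _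
  linarith

end PrimalDual

end ChambollePock

end

/-! ### Convergence of the Chambolle–Pock iteration. -/

theorem corollary5p3 {n m : ℕ}
    (A : SetOp (Fin n)) (B : SetOp (Fin m)) (L : Matrix (Fin m) (Fin n) ℝ) (hL : L ≠ 0)
    (hA : OuterSemicontinuous A) (hB : OuterSemicontinuous B)
    (γ τ : ℝ) (hγ : 0 < γ) (hτ : 0 < τ)
    (hJA : FullDomain (resolventOp (scale γ A)))
    (hJB : FullDomain (resolventOp (scale τ (invOp B))))
    (μA μB ρA ρB : ℝ) (hmod : ModuliCondition L μA μB ρA ρB)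
    (S : Set (Vec (Fin n ⊕ Fin m))) (hS : S.Nonempty) (hSzer : S ⊆ zer (primalDual A B L))
    (hSA : ∀ xs ys, pair xs ys ∈ S →
      SemimonotoneAt A (μA • (Lᵀ * L)) (ρA • 1) xs (-act Lᵀ ys))
    (hSB : ∀ xs ys, pair xs ys ∈ S →
      SemimonotoneAt B (μB • 1) (ρB • (L * Lᵀ)) (act L xs) ys)
    (hstep : StepsizeRule L μA μB ρA ρB γ τ)
    (lam : ℕ → ℝ) (hlam : RelaxationRule L μA μB ρA ρB γ τ lam)
    (x : ℕ → Vec (Fin n)) (y : ℕ → Vec (Fin m))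
    (xb : ℕ → Vec (Fin n)) (yb : ℕ → Vec (Fin m))
    (hgen : IsGenerated A B L γ τ lam x y xb yb)
    (z zb : ℕ → Vec (Fin n ⊕ Fin m))
    (hz : ∀ k, z k = pair (x k) (y k)) (hzb : ∀ k, zb k = pair (xb k) (yb k)) :
    ((∃ k, zb k ∈ zer (primalDual A B L)) ∨
      ((∀ k, act (precond L γ τ) (z k - zb k) ∈ primalDual A B L (zb k)) ∧
        Tendsto (fun k => act (precond L γ τ) (z k - zb k)) atTop (𝓝 0) ∧
        (∀ p, MapClusterPt p atTop zb → p ∈ zer (primalDual A B L)) ∧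
        Bornology.IsBounded (Set.range fun k => projRange L γ τ (z k)) ∧
        Bornology.IsBounded (Set.range fun k => projRange L γ τ (zb k)))) ∧
    (SingleValuedContinuous (resolventOp (scale γ A)) →
      SingleValuedContinuous (resolventOp (scale τ (invOp B))) →
      (∀ p, MapClusterPt p atTop (fun k => projRange L γ τ (z k)) →
        p ∈ projRange L γ τ '' zer (primalDual A B L)) ∧
      (S = zer (primalDual A B L) →
        (∃ p ∈ projRange L γ τ '' zer (primalDual A B L),
          Tendsto (fun k => projRange L γ τ (z k)) atTop (𝓝 p)) ∧
        (∃ p ∈ zer (primalDual A B L), Tendsto zb atTop (𝓝 p)) ∧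
        ((∃ ε > 0, ∀ k, lam k ∈ Set.Icc ε (2 - ε)) →
          ∃ p ∈ zer (primalDual A B L), Tendsto z atTop (𝓝 p)))) := by
  have hle := hstep.mul_le_one hL hγ
  have hP : (Matrix.toEuclideanLin (precond L γ τ)).IsSymmetric := isSymmetric_precond
  have hC : 0 < 1 / γ + 1 / τ := by positivity
  have hPC := norm_precond_sq_le (L := L) hγ hτ hle
  have hstepz : ∀ k, z (k + 1) = z k + lam k • (zb k - z k) := fun k => by
    rw [hz, hz, hzb, (hgen k).2.2.1, (hgen k).2.2.2, pair_sub, smul_pair, pair_add]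
  have hmem : ∀ k, act (precond L γ τ) (z k - zb k) ∈ primalDual A B L (zb k) := fun k => by
    rw [hz, hzb]
    exact precond_residual_mem hγ hτ (hgen k).1 (hgen k).2.1
  have hminty : ∀ w ∈ S, ∀ k,
      (etaBar L μA μB ρA ρB γ τ - 1) *
          inner ℝ (z k - zb k) (Matrix.toEuclideanLin (precond L γ τ) (z k - zb k)) ≤
        inner ℝ (zb k - w) (Matrix.toEuclideanLin (precond L γ τ) (z k - zb k)) := fun w hw k => by
    obtain ⟨xs, ys, rfl⟩ : ∃ xs ys, w = pair xs ys := ⟨_, _, (pair_blocks w).symm⟩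
    exact weak_minty hL hγ hτ hmod hstep (hSA xs ys hw) (hSB xs ys hw) (hmem k)
  have hanti : ∀ w ∈ S, Antitone fun k =>
      inner ℝ (z k - w) (Matrix.toEuclideanLin (precond L γ τ) (z k - w)) := fun w hw =>
    seminorm_antitone hP hPC hC hstepz hlam.1 (hminty w hw)
  obtain ⟨w₀, hw₀⟩ := hS
  have hres : Tendsto (fun k => Matrix.toEuclideanLin (precond L γ τ) (z k - zb k)) atTop (𝓝 0) :=
    residual_tendsto_zero hP hPC hC hstepz hlam.1 hlam.2 (hminty w₀ hw₀)
  have hcl : ∀ p, MapClusterPt p atTop zb → p ∈ zer (primalDual A B L) := fun p hp => by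
    obtain ⟨ψ, hψ, hlim⟩ := hp.tendsto_subseq
    exact outerSemicontinuous_primalDual hA hB p _ _ 0 hlim (hres.comp hψ.tendsto_atTop)
      fun k => hmem (ψ k)
  have hbz := isBounded_range_apply hPC hC (hanti w₀ hw₀)
  have hbzb : Bornology.IsBounded
      (Set.range fun k => Matrix.toEuclideanLin (precond L γ τ) (zb k)) := by
    refine (hbz.sub (Metric.isBounded_range_of_tendsto _ hres)).subset ?_
    rintro _ ⟨k, rfl⟩
    exact ⟨_, ⟨k, rfl⟩, _, ⟨k, rfl⟩, by simp only [map_sub, sub_sub_cancel]⟩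
  -- The second alternative always holds: finding a zero at some step does not interrupt the
  -- estimates.
  refine ⟨Or.inr ⟨hmem, hres, hcl, isBounded_range_starProjection hP hbz,
    isBounded_range_starProjection hP hbzb⟩, fun hJA' hJB' => ?_⟩
  obtain ⟨f, hf, hfstep⟩ := exists_continuous_step (L := L) hγ hτ hJA' hJB'
  have hzbf : ∀ k, zb k = f (Matrix.toEuclideanLin (precond L γ τ) (z k)) := fun k => by
    rw [hz, hzb]
    exact hfstep _ _ _ _ (hgen k).1 (hgen k).2.1
  refine ⟨fun p hp => ⟨_, clusterPt_mem_image hP hres hcl hf hzbf hp⟩, fun hSeq => ?_⟩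
  obtain ⟨h1, p, hp, hlim⟩ := exists_tendsto_of_antitone hP hPC hC hres (hSeq ▸ ⟨w₀, hw₀⟩) hcl hf
    hzbf (hSeq ▸ hanti)
  exact ⟨h1, ⟨p, hp, hlim⟩, fun ⟨ε, hε, hl⟩ => ⟨p, hp, tendsto_of_relaxed_step hstepz hε hl hlim⟩⟩
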